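/- **Setting.** A finite extensive game $\Gamma$ consists of a finite set $N$ of players, a finite set $A$ of actions, a finite prefix-closed set $H$ of histories (finite sequences of actions) with terminal histories $Z$, a player function $P$ with values in $N\cup\{c\}$ on nonterminal histories, a fixed strategy $\sigma_c$ of chance $c$, utilities $u_i:Z\to\mathbb R$, and for each player $i$ a partition $\mathcal I_i$ of $H_i=\{h: P(h)=i\}$ into information sets, with $A(h)=\{a: ha\in H\}$ constant on each $I\in\mathcal I_i$ (denoted $A(I)$); no information set is met twice along a history. For $h\sqsubseteq z$, $X_i(h,z)$ is the sequence of (information set, action) pairs of player $i$ between $h$ and $z$, $X_{-i}(h,z)$ that of all the other players (chance excluded), and $X_{\pm i}(z)=X_{\pm i}(\emptyset,z)$. For a behavioural strategy profile $\sigma$, $\pi^\sigma_p(h,z)$ is the contribution of $p\in N\cup\{c\}$ to the probability of reaching $z$ from $h$, $\pi^\sigma=\prod_p\pi_p^\sigma$, $\pi_{-i}^\sigma=\prod_{p\ne i}\pi_p^\sigma$, and $u_i(\sigma)=\sum_{z\in Z}u_i(z)\pi^\sigma(z)$. $Z_I$ is the set of terminal histories with a prefix in $I$, and $z[I]$ is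 that prefix. The game has perfect recall if $X_i(h)=X_i(h')$ whenever $h,h'$ lie in the same information set of $i$. A perfect recall refinement $\breve\Gamma$ of $\Gamma$ is a game with perfect recall that differs from $\Gamma$ only in its information partitions $\breve{\mathcal I}_i$, each of which refines $\mathcal I_i$; $\breve{\mathcal P}(I)=\{\breve I\in\breve{\mathcal I}_i:\breve I\subseteq I\}$ for $I\in\mathcal I_i$. $\Gamma$ is *skew well-formed with respect to* $\breve\Gamma$ if for all $i\in N$, $I\in\mathcal I_i$ and $\breve I,\breve I'\in\breve{\mathcal P}(I)$ there are a bijection $\phi:Z_{\breve I}\to Z_{\breve I'}$ and constants $k_{\breve I,\breve I'},\delta_{\breve I,\breve I'},\ell_{\breve I,\breve I'}\in[0,\infty)$ such that for all $z\in Z_{\breve I}$: (i) $|u_i(z)-k_{\breve I,\breve I'}u_i(\phi(z))|\le\delta_{\breve I,\breve I'}$; (ii) $\pi_c(z)=\ell_{\breve I,\breve I'}\pi_c(\phi(z))$; and, in $\Gamma$, (iii) $X_{-i}(z)=X_{-i}(\phi(z))$ and (iv) $X_i(z[\breve I],z)=X_i(\phi(z)[\breve I'],\phi(z))$. For $\breve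 I=\breve I'$ the identity bijection is always admissible, and the constants for such a pair are taken to be the trivial ones, $k_{\breve I,\breve I}=\ell_{\breve I,\breve I}=1$. Player $i$ plays according to *CFR in* $\Gamma$ if, with $v_i(\sigma,I)=\sum_{z\in Z_I}u_i(z)\,\pi_{-i}^\sigma(z[I])\,\pi^\sigma(z[I],z)$ and $R_i^T(I,a)=\sum_{t=1}^T\big(v_i(\sigma^t_{I\to a},I)-v_i(\sigma^t,I)\big)$, where $\sigma_{I\to a}$ is $\sigma$ except that $a$ is always taken at $I$, one has for all $T\ge0$, $I\in\mathcal I_i$, $a\in A(I)$ $$\sigma_i^{T+1}(I,a)=\frac{\max\{R_i^T(I,a),0\}}{\sum_{b\in A(I)}\max\{R_i^T(I,b),0\}},$$ or $\sigma_i^{T+1}(I,a)=1/|A(I)|$ if the denominator is zero. **Theorem 2.** Let $\Gamma$ be skew well-formed with respect to $\breve\Gamma$, with constants as above, and let $\sigma^1,\sigma^2,\dots$ be strategy profiles of $\Gamma$ in which player $i$ plays according to CFR in $\Gamma$. Then for every $T\ge1$ the regret of player $i$ in $\breve\Gamma$, $$\breve R_i^T=\max_{\sigma'\in\breve\Sigma_i}\sum_{t=1}^T\big(u_i(\sigma',\sigma_{-i}^t)-u_i(\sigma^t)\big),$$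 where $\breve\Sigma_i$ is the set of behavioural strategies of $i$ in $\breve\Gamma$, satisfies $$\frac{\breve R_i^T}{T}\le\frac{\Delta_iK\sqrt{|A_i|}}{\sqrt T}+\sum_{I\in\mathcal I_i}|\breve{\mathcal P}(I)|\,\delta_I,$$ where $\Delta_i=\max_{z,z'\in Z}(u_i(z)-u_i(z'))$, $|A_i|=\max_{I\in\mathcal I_i}|A(I)|$, $K=\sum_{I\in\mathcal I_i}\max_{\breve I,\breve I'\in\breve{\mathcal P}(I)}k_{\breve I,\breve I'}\ell_{\breve I,\breve I'}$ and $\delta_I=\max_{\breve I,\breve I'\in\breve{\mathcal P}(I)}\delta_{\breve I,\breve I'}\ell_{\breve I,\breve I'}$. -/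

import Mathlib

/-- The part of a finite extensive-form game that a game shares with its abstractions: histories,
the player function, chance and utilities. `N` is the set of players, `A` the set of actions,
a history is a finite sequence of actions, and `turn h = none` means that chance acts at `h`. -/
structure GameTree (N A : Type*) [DecidableEq A] [Fintype A] where
  /-- the finite set of histories -/
  H : Finset (List A)
  root_mem : [] ∈ H
  prefix_closed : ∀ h a, h ++ [a] ∈ H → h ∈ H
  /-- the player to act; only its values at nonterminal histories matter -/
  turn : List A → Option N
  /-- the fixed strategy of chance -/
  chance : List A → A → ℝ
  chance_nonneg : ∀ h ∈ H, turn h = none → ∀ a, h ++ [a] ∈ H → 0 ≤ chance h a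
  chance_sum : ∀ h ∈ H, turn h = none → (∃ a, h ++ [a] ∈ H) →
    ∑ a ∈ Finset.univ.filter (fun a => h ++ [a] ∈ H), chance h a = 1
  /-- utilities; only their values at terminal histories matter -/
  u : N → List A → ℝ

noncomputable section

namespace GameTree

variable {N A : Type*} [Fintype N] [DecidableEq N] [Fintype A] [DecidableEq A]

/-- The set `A(h)` of actions available at `h`. -/
def acts (G : GameTree N A) (h : List A) : Finset A :=
  Finset.univ.filter (fun a => h ++ [a] ∈ G.H)

/-- The set `Z` of terminal histories. -/
def terminals (G : GameTree N A) : Finset (List A) :=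
  G.H.filter (fun h => G.acts h = ∅)

/-- The set `H_i` of (nonterminal) histories at which player `i` acts. -/
def nodes (G : GameTree N A) (i : N) : Finset (List A) :=
  G.H.filter (fun h => (G.acts h).Nonempty ∧ G.turn h = some i)

/-- The pairs `(g, a)` with `h ⊑ g` and `g a ⊑ z`, in the order in which they occur;
empty if `h` is not a prefix of `z`. -/
def decisions (h z : List A) : List (List A × A) :=
  if h <+: z then (z.inits.zip z).drop h.length else []

/-- An information structure: for each player `i` a partition of `H_i` into information sets with
constant action sets, such that no information set is met twice along a history.
A game is a pair `(G, 𝓘)`. -/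
structure Info (G : GameTree N A) where
  part : ∀ i : N, Finpartition (G.nodes i)
  acts_eq : ∀ i, ∀ I ∈ (part i).parts, ∀ h ∈ I, ∀ h' ∈ I, G.acts h = G.acts h'
  no_repeat : ∀ i, ∀ h ∈ G.nodes i, ∀ h' ∈ G.nodes i, h <+: h' → h ≠ h' →
    (part i).part h ≠ (part i).part h'

variable {G : GameTree N A}

/-- The information sets `𝓘_i` of player `i`. -/
def Info.sets (𝓘 : G.Info) (i : N) : Finset (Finset (List A)) := (𝓘.part i).parts

/-- The actions `A(I)` available at an information set (`acts` is constant on `I`). -/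
def actsAt (G : GameTree N A) (I : Finset (List A)) : Finset A := I.biUnion G.acts

/-- The sequence of (information set, action) pairs between `h` and `z` that belong to the players
satisfying `Q`. -/
def Info.seqOf (𝓘 : G.Info) (Q : N → Prop) [DecidablePred Q] (h z : List A) :
    List (Finset (List A) × A) :=
  (decisions h z).filterMap (fun s =>
    match G.turn s.1 with
    | none => none
    | some j => if Q j then some ((𝓘.part j).part s.1, s.2) else none)

/-- `X_i(h, z)`. -/
def Info.ownSeq (𝓘 : G.Info) (i : N) (h z : List A) : List (Finset (List A) × A) :=
  𝓘.seqOf (fun j => j = i) h z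

/-- `X_{-i}(h, z)`. -/
def Info.oppSeq (𝓘 : G.Info) (i : N) (h z : List A) : List (Finset (List A) × A) :=
  𝓘.seqOf (fun j => j ≠ i) h z

/-- Perfect recall. -/
def Info.PerfectRecall (𝓘 : G.Info) : Prop :=
  ∀ i, ∀ I ∈ 𝓘.sets i, ∀ h ∈ I, ∀ h' ∈ I, 𝓘.ownSeq i [] h = 𝓘.ownSeq i [] h'

/-- `𝓘` is an abstraction of `𝓙` (on the same game tree). -/
def Info.IsAbstractionOf (𝓘 𝓙 : G.Info) : Prop :=
  ∀ i, ∀ h ∈ G.nodes i, ∀ h' ∈ G.nodes i,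
    (𝓙.part i).part h = (𝓙.part i).part h' → (𝓘.part i).part h = (𝓘.part i).part h'

/-- `𝓙` is a perfect recall refinement of `𝓘`. -/
def Info.IsPerfectRecallRefinement (𝓙 𝓘 : G.Info) : Prop :=
  𝓙.PerfectRecall ∧ 𝓘.IsAbstractionOf 𝓙

/-- The information sets of player `i` in the refinement `𝓙` that are contained in `I`. -/
def Info.refined (𝓙 : G.Info) (i : N) (I : Finset (List A)) : Finset (Finset (List A)) :=
  (𝓙.sets i).filter (fun J => J ⊆ I)

/-- `s` is a behavioural strategy of player `i`: a probability distribution over the available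
actions at each `h ∈ H_i`, constant on information sets. -/
def Info.IsStrategy (𝓘 : G.Info) (i : N) (s : List A → A → ℝ) : Prop :=
  (∀ h ∈ G.nodes i, (∀ a ∈ G.acts h, 0 ≤ s h a) ∧ ∑ a ∈ G.acts h, s h a = 1) ∧
  ∀ I ∈ 𝓘.sets i, ∀ h ∈ I, ∀ h' ∈ I, ∀ a ∈ G.acts h, s h a = s h' a

/-- `σ` is a strategy profile. -/
def Info.IsProfile (𝓘 : G.Info) (σ : N → List A → A → ℝ) : Prop :=
  ∀ i, 𝓘.IsStrategy i (σ i)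

/-- The probability of action `a` at `h` under the profile `σ` (and the chance strategy). -/
def prob (G : GameTree N A) (σ : N → List A → A → ℝ) (h : List A) (a : A) : ℝ :=
  match G.turn h with
  | none => G.chance h a
  | some j => σ j h a

/-- `π_p^σ(h, z)`: the contribution of `p` (a player, or chance if `p = none`) to reaching `z`
from its prefix `h`. -/
def playProb (G : GameTree N A) (σ : N → List A → A → ℝ) (p : Option N) (h z : List A) : ℝ :=
  (((decisions h z).filter (fun s => G.turn s.1 = p)).map (fun s => G.prob σ s.1 s.2)).prod

/-- `π^σ(h, z)`. -/
def reach (G : GameTree N A) (σ : N → List A → A → ℝ) (h z : List A) : ℝ :=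
  ∏ p : Option N, G.playProb σ p h z

/-- `π_{-i}^σ(h, z)`: the contribution of chance and of all players other than `i`. -/
def reachOpp (G : GameTree N A) (σ : N → List A → A → ℝ) (i : N) (h z : List A) : ℝ :=
  ∏ p ∈ Finset.univ.erase (some i), G.playProb σ p h z

/-- `π_c(z)`: the contribution of chance to reaching `z`. -/
def chanceProb (G : GameTree N A) (z : List A) : ℝ :=
  (((decisions [] z).filter (fun s => G.turn s.1 = none)).map
    (fun s => G.chance s.1 s.2)).prod

/-- The expected utility `u_i(σ)`. -/
def value (G : GameTree N A) (i : N) (σ : N → List A → A → ℝ) : ℝ :=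
  ∑ z ∈ G.terminals, G.u i z * G.reach σ [] z

/-- `Z_I`: the terminal histories passing through `I`. -/
def through (G : GameTree N A) (I : Finset (List A)) : Finset (List A) :=
  G.terminals.filter (fun z => ∃ h ∈ I, h <+: z)

/-- `z[I]`: the prefix of `z` that lies in `I`, for `z ∈ Z_I`. -/
def prefixIn (I : Finset (List A)) (z : List A) : List A :=
  (z.inits.find? (fun h => h ∈ I)).getD []

/-- The counterfactual value `v_i(σ, I)`. -/
def cfValue (G : GameTree N A) (i : N) (σ : N → List A → A → ℝ) (I : Finset (List A)) : ℝ :=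
  ∑ z ∈ G.through I,
    G.u i z * G.reachOpp σ i [] (prefixIn I z) * G.reach σ (prefixIn I z) z

/-- `σ_{I → a}` for an information set `I` of player `i`: the profile `σ`, except that `a` is always
taken at `I`. -/
def switchTo (σ : N → List A → A → ℝ) (i : N) (I : Finset (List A)) (a : A) :
    N → List A → A → ℝ :=
  Function.update σ i (fun h b => if h ∈ I then (if b = a then 1 else 0) else σ i h b)

/-- The cumulative counterfactual regret `R_i^T(I, a)` of the first `T` profiles
`σ 0, …, σ (T - 1)`. -/
def cfRegret (G : GameTree N A) (i : N) (σ : ℕ → N → List A → A → ℝ) (T : ℕ)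
    (I : Finset (List A)) (a : A) : ℝ :=
  ∑ t ∈ Finset.range T, (G.cfValue i (switchTo (σ t) i I a) I - G.cfValue i (σ t) I)

/-- Player `i` plays according to CFR in the game `(G, 𝓘)`: each strategy is obtained by regret
matching from the cumulative counterfactual regrets of the previous profiles, with uniform play when
no regret is positive (in particular for the first profile `σ 0`). -/
def Info.IsCFR (𝓘 : G.Info) (i : N) (σ : ℕ → N → List A → A → ℝ) : Prop :=
  ∀ T : ℕ, ∀ I ∈ 𝓘.sets i, ∀ h ∈ I, ∀ a ∈ G.actsAt I,
    σ T i h a =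
      if ∑ b ∈ G.actsAt I, max (G.cfRegret i σ T I b) 0 = 0 then
        1 / ((G.actsAt I).card : ℝ)
      else
        max (G.cfRegret i σ T I a) 0 / ∑ b ∈ G.actsAt I, max (G.cfRegret i σ T I b) 0

/-- The total gains over the first `T` rounds that player `i` could have made by fixed strategies
`s` of the game `(G, 𝓙)`. -/
def Info.gains (𝓙 : G.Info) (i : N) (σ : ℕ → N → List A → A → ℝ) (T : ℕ) : Set ℝ :=
  {x | ∃ s, 𝓙.IsStrategy i s ∧
    x = ∑ t ∈ Finset.range T, (G.value i (Function.update (σ t) i s) - G.value i (σ t))}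

/-- The regret `R_i^T` of player `i` in the game `(G, 𝓙)`. -/
def Info.regret (𝓙 : G.Info) (i : N) (σ : ℕ → N → List A → A → ℝ) (T : ℕ) : ℝ :=
  sSup (𝓙.gains i σ T)

/-- `(G, 𝓘)` is skew well-formed with respect to the refinement `(G, 𝓙)`, with the constants
`k J J'`, `δ J J'`, `ℓ J J'`. (Information sets of different players are disjoint, so the constants
need not be indexed by the player.) -/
def Info.IsSkewWellFormed (𝓘 𝓙 : G.Info)
    (k δ ℓ : Finset (List A) → Finset (List A) → ℝ) : Prop :=
  𝓙.IsPerfectRecallRefinement 𝓘 ∧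
  ∀ i, ∀ I ∈ 𝓘.sets i, ∀ J ∈ 𝓙.refined i I, ∀ J' ∈ 𝓙.refined i I,
    0 ≤ k J J' ∧ 0 ≤ δ J J' ∧ 0 ≤ ℓ J J' ∧
    ∃ φ : List A → List A,
      Set.BijOn φ (G.through J : Set (List A)) (G.through J' : Set (List A)) ∧
      ∀ z ∈ G.through J,
        |G.u i z - k J J' * G.u i (φ z)| ≤ δ J J' ∧
        G.chanceProb z = ℓ J J' * G.chanceProb (φ z) ∧
        𝓘.oppSeq i [] z = 𝓘.oppSeq i [] (φ z) ∧
        𝓘.ownSeq i (prefixIn J z) z = 𝓘.ownSeq i (prefixIn J' (φ z)) (φ z)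

/-- `Δ_i`: the maximum of `u_i(z) - u_i(z')` over terminal histories. -/
def utilRange (G : GameTree N A) (i : N) : ℝ :=
  sSup ((fun p : List A × List A => G.u i p.1 - G.u i p.2) ''
    ((G.terminals ×ˢ G.terminals : Finset (List A × List A)) : Set (List A × List A)))

/-- The maximum of `f J J'` over the pairs of information sets of the refinement `𝓙` inside `I`. -/
def Info.maxPairs (𝓙 : G.Info) (i : N) (I : Finset (List A))
    (f : Finset (List A) → Finset (List A) → ℝ) : ℝ :=
  sSup ((fun p : Finset (List A) × Finset (List A) => f p.1 p.2) ''
    ((𝓙.refined i I ×ˢ 𝓙.refined i I : Finset (Finset (List A) × Finset (List A))) :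
      Set (Finset (List A) × Finset (List A))))

/-- `|A_i|`: the maximal number of actions at an information set of player `i`. -/
def Info.maxActs (𝓘 : G.Info) (i : N) : ℕ :=
  (𝓘.sets i).sup (fun I => (G.actsAt I).card)

end GameTree

end

set_option linter.unusedSectionVars false

noncomputable section

namespace GameTree

variable {N A : Type*} [Fintype N] [DecidableEq N] [Fintype A] [DecidableEq A]
variable {G : GameTree N A}

/-! ### Products along paths -/

/-! A gain is affine in the behaviour at each information set, so a comparator in the refinement may
be taken pure (`Info.exists_pure`). Its gain telescopes over the tree (`payoff_sub_payoff`). By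
perfect recall its own reach probability is constant, 0 or 1, on every refined set. Hence the gain
is the sum, over the refined sets it plays to reach, of the counterfactual regret for the action
chosen there (`Info.PerfectRecall.value_update_sub_eq`). Each coarse set I is treated separately;
let P be its parts and S the reached ones.

Regret matching controls only the sum over P of the regrets for one action, whereas the comparator
may act differently in each part. Skew well-formedness transfers the control: under a profile of the
coarse game the weight of a terminal history is a product of chance and of functions of the
sequences that φ preserves. So the opponents' reach probabilities q of two parts have a constant
ratio ℓ, and the regrets agree up to the factor kℓ and an error 2δℓq
(`Info.IsSkewWellFormed.oppReach_eq`, `Info.IsSkewWellFormed.abs_regretAt_sub_le`). Moreover q ≤ 1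
on each part (`Info.PerfectRecall.oppReach_le_one`), and the sum of q over S is at most 1
(`sum_support_oppReach_le_one`).

The heart is `scaled_regret_le`, unscaled in `regret_le`: for j in S the regret is at most K n Δ L +
D (T + |P \ S| Θ), where L and Θ are the ℓ² and ℓ¹ norms over time of q at j, n = √|A(I)|, and K, D
are the maxima of kℓ and δℓ. Over S the L sum to at most √T, by proportionality, and the Θ to at
most T; the error becomes D |P| T. Thus no factor |P| enters the first term, and the 2 of the
transfer disappears from the second.

For the heart, suppose the bound fails at j. Regret matching makes the sum of the costs C k = η b k
- ρ k nonnegative, while C j is very negative, so other parts must have positive cost. Each cost is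
bounded through the reach of its part, and reach in S is scarce; the few remaining configurations
are refuted by scalar inequalities. -/

theorem zip_inits_concat (z : List A) (a : A) :
    (z ++ [a]).inits.zip (z ++ [a]) = z.inits.zip z ++ [(z, a)] := by
  induction z with
  | nil => simp
  | cons b z ih =>
    simp only [List.cons_append, List.inits_cons, List.zip_cons_cons, List.zip_map_left, ih,
      List.map_append]
    simp

theorem decisions_self (h : List A) : decisions h h = [] := by
  simp [decisions]

theorem decisions_concat {h z : List A} (hz : h <+: z) (a : A) :
    decisions h (z ++ [a]) = decisions h z ++ [(z, a)] := by
  have h1 : h <+: z ++ [a] := hz.trans (List.prefix_append _ _)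
  have := hz.length_le
  simp only [decisions, hz, h1, if_true, zip_inits_concat]
  rw [List.drop_append_of_le_length]
  simpa using this

theorem prefix_induction {h : List A} {P : List A → Prop} (h0 : P h)
    (h1 : ∀ z a, h <+: z → P z → P (z ++ [a])) {z : List A} (hz : h <+: z) : P z := by
  obtain ⟨t, rfl⟩ := hz
  induction t using List.reverseRecOn with
  | nil => simpa using h0
  | append_singleton t a ih =>
    rw [← List.append_assoc]
    exact h1 _ _ (List.prefix_append _ _) ih

theorem mem_decisions {h z : List A} (hz : h <+: z) {s : List A × A} (hs : s ∈ decisions h z) :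
    h <+: s.1 ∧ s.1 ++ [s.2] <+: z := by
  revert s
  refine prefix_induction (P := fun z => ∀ {s}, s ∈ decisions h z → h <+: s.1 ∧ s.1 ++ [s.2] <+: z)
    ?_ ?_ hz
  · simp [decisions_self]
  · intro z a hz ih s hs
    rw [decisions_concat hz, List.mem_append] at hs
    rcases hs with hs | hs
    · exact ⟨(ih hs).1, (ih hs).2.trans (List.prefix_append _ _)⟩
    · simp only [List.mem_singleton] at hs
      subst hs
      exact ⟨hz, List.prefix_rfl⟩

/-- The product of `f` over the decisions between `h` and `z`. -/
def pathProd (f : List A → A → ℝ) (h z : List A) : ℝ :=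
  ((decisions h z).map (fun s => f s.1 s.2)).prod

theorem pathProd_self (f : List A → A → ℝ) (h : List A) : pathProd f h h = 1 := by
  simp [pathProd, decisions_self]

theorem pathProd_concat (f : List A → A → ℝ) {h z : List A} (hz : h <+: z) (a : A) :
    pathProd f h (z ++ [a]) = pathProd f h z * f z a := by
  simp [pathProd, decisions_concat hz]

theorem pathProd_trans (f : List A → A → ℝ) {h g z : List A} (hg : h <+: g) (hz : g <+: z) :
    pathProd f h z = pathProd f h g * pathProd f g z := by
  refine prefix_induction (P := fun z => pathProd f h z = pathProd f h g * pathProd f g z)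
    ?_ ?_ hz
  · simp [pathProd_self]
  · intro z a hz ih
    rw [pathProd_concat f hz, pathProd_concat f (hg.trans hz), ih, mul_assoc]

theorem pathProd_step (f : List A → A → ℝ) {h z : List A} {a : A} (hz : h ++ [a] <+: z) :
    pathProd f h z = f h a * pathProd f (h ++ [a]) z := by
  rw [pathProd_trans f (List.prefix_append h [a]) hz, pathProd_concat f List.prefix_rfl,
    pathProd_self, one_mul]

theorem pathProd_congr {f f' : List A → A → ℝ} {h z : List A} (hz : h <+: z)
    (hf : ∀ g a, h <+: g → g ++ [a] <+: z → f g a = f' g a) :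
    pathProd f h z = pathProd f' h z := by
  unfold pathProd
  congr 1
  refine List.map_congr_left fun s hs => ?_
  exact hf _ _ (mem_decisions hz hs).1 (mem_decisions hz hs).2

theorem pathProd_mul (f f' : List A → A → ℝ) (h z : List A) :
    pathProd (fun g a => f g a * f' g a) h z = pathProd f h z * pathProd f' h z := by
  simp [pathProd, List.prod_map_mul]

theorem pathProd_nonneg {f : List A → A → ℝ} {h z : List A} (hz : h <+: z)
    (hf : ∀ g a, h <+: g → g ++ [a] <+: z → 0 ≤ f g a) : 0 ≤ pathProd f h z := by
  apply List.prod_nonneg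
  intro x hx
  obtain ⟨s, hs, rfl⟩ := List.mem_map.1 hx
  exact hf _ _ (mem_decisions hz hs).1 (mem_decisions hz hs).2

theorem prod_map_filter_eq {α : Type*} (l : List α) (p : α → Bool) (f : α → ℝ) :
    ((l.filter p).map f).prod = (l.map (fun s => if p s then f s else 1)).prod := by
  induction l with
  | nil => simp
  | cons x l ih =>
    by_cases hx : p x <;> simp [hx, ih]

theorem playProb_eq_pathProd (σ : N → List A → A → ℝ) (p : Option N) (h z : List A) :
    G.playProb σ p h z = pathProd (fun g a => if G.turn g = p then G.prob σ g a else 1) h z := by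
  simp [playProb, prod_map_filter_eq, pathProd]

theorem prod_playProb (σ : N → List A → A → ℝ) (B : Finset (Option N)) (h z : List A) :
    ∏ p ∈ B, G.playProb σ p h z =
      pathProd (fun g a => if G.turn g ∈ B then G.prob σ g a else 1) h z := by
  simp only [playProb_eq_pathProd, pathProd]
  induction decisions h z with
  | nil => simp
  | cons s l ih =>
    simp only [List.map_cons, List.prod_cons, Finset.prod_mul_distrib, ih]
    rw [Finset.prod_ite_eq B (G.turn s.1) (fun _ => G.prob σ s.1 s.2)]

theorem reach_eq_pathProd (σ : N → List A → A → ℝ) (h z : List A) :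
    G.reach σ h z = pathProd (G.prob σ) h z := by
  rw [reach, prod_playProb]
  simp

theorem reachOpp_eq_pathProd (σ : N → List A → A → ℝ) (i : N) (h z : List A) :
    G.reachOpp σ i h z =
      pathProd (fun g a => if G.turn g = some i then 1 else G.prob σ g a) h z := by
  rw [reachOpp, prod_playProb]
  simp

/-- The contribution of player `i` times that of everybody else. -/
theorem reach_eq_own_mul_opp (σ : N → List A → A → ℝ) (i : N) (h z : List A) :
    G.reach σ h z = G.playProb σ (some i) h z * G.reachOpp σ i h z := by
  rw [reach_eq_pathProd, playProb_eq_pathProd, reachOpp_eq_pathProd, ← pathProd_mul]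
  congr 1
  ext g a
  split_ifs <;> simp

theorem reach_self (σ : N → List A → A → ℝ) (h : List A) : G.reach σ h h = 1 := by
  rw [reach_eq_pathProd, pathProd_self]

theorem reach_trans (σ : N → List A → A → ℝ) {h g z : List A} (hg : h <+: g) (hz : g <+: z) :
    G.reach σ h z = G.reach σ h g * G.reach σ g z := by
  simp only [reach_eq_pathProd, pathProd_trans _ hg hz]

theorem reach_step (σ : N → List A → A → ℝ) {h z : List A} {a : A} (hz : h ++ [a] <+: z) :
    G.reach σ h z = G.prob σ h a * G.reach σ (h ++ [a]) z := by
  simp only [reach_eq_pathProd, pathProd_step _ hz]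

theorem reachOpp_trans (σ : N → List A → A → ℝ) (i : N) {h g z : List A} (hg : h <+: g)
    (hz : g <+: z) : G.reachOpp σ i h z = G.reachOpp σ i h g * G.reachOpp σ i g z := by
  simp only [reachOpp_eq_pathProd, pathProd_trans _ hg hz]

/-- `σ` and `σ'` agree except for player `i`. -/
theorem reachOpp_congr {σ σ' : N → List A → A → ℝ} {i : N} (h : ∀ j, j ≠ i → σ j = σ' j)
    (g z : List A) : G.reachOpp σ i g z = G.reachOpp σ' i g z := by
  simp only [reachOpp_eq_pathProd]
  congr 1
  ext g a
  split_ifs with hi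
  · rfl
  · unfold prob
    split
    · rfl
    · next j hj => rw [h j (by rintro rfl; exact hi hj)]

/-! ### Recursion on the tree -/

theorem prefix_mem (G : GameTree N A) {h z : List A} (hz : h <+: z) (hzH : z ∈ G.H) :
    h ∈ G.H := by
  revert hzH
  refine prefix_induction (P := fun z => z ∈ G.H → h ∈ G.H) id ?_ hz
  intro z a _ ih hza
  exact ih (G.prefix_closed _ _ hza)

theorem mem_acts {h : List A} {a : A} : a ∈ G.acts h ↔ h ++ [a] ∈ G.H := by
  simp [acts]

theorem prefix_iff_eq_or_concat {h g : List A} : h <+: g ↔ h = g ∨ ∃ a, h ++ [a] <+: g := by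
  constructor
  · rintro ⟨t, rfl⟩
    cases t with
    | nil => simp
    | cons a t => exact Or.inr ⟨a, ⟨t, by simp⟩⟩
  · rintro (rfl | ⟨a, ha⟩)
    · exact List.prefix_rfl
    · exact (List.prefix_append _ _).trans ha

theorem not_concat_prefix_self (h : List A) (a : A) : ¬ h ++ [a] <+: h := by
  intro hh
  have := hh.length_le
  simp at this

theorem eq_of_concat_prefix {h g : List A} {a b : A} (ha : h ++ [a] <+: g) (hb : h ++ [b] <+: g) :
    a = b := by
  obtain ⟨s, rfl⟩ := ha
  obtain ⟨t, ht⟩ := hb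
  simp only [List.append_assoc, List.append_cancel_left_eq, List.cons_append,
    List.nil_append, List.cons.injEq] at ht
  exact ht.1.symm

/-- The histories that extend `h`. -/
def below (G : GameTree N A) (h : List A) : Finset (List A) := G.H.filter (fun g => h <+: g)

theorem below_eq {h : List A} (hh : h ∈ G.H) :
    G.below h = insert h ((G.acts h).biUnion (fun a => G.below (h ++ [a]))) := by
  ext g
  simp only [below, Finset.mem_filter, Finset.mem_insert, Finset.mem_biUnion, mem_acts]
  constructor
  · rintro ⟨hg, hp⟩
    rcases prefix_iff_eq_or_concat.1 hp with rfl | ⟨a, ha⟩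
    · exact Or.inl rfl
    · exact Or.inr ⟨a, G.prefix_mem ha hg, hg, ha⟩
  · rintro (rfl | ⟨a, -, hg, ha⟩)
    · exact ⟨hh, List.prefix_rfl⟩
    · exact ⟨hg, (List.prefix_append _ _).trans ha⟩

theorem sum_below (F : List A → ℝ) {h : List A} (hh : h ∈ G.H) :
    ∑ g ∈ G.below h, F g = F h + ∑ a ∈ G.acts h, ∑ g ∈ G.below (h ++ [a]), F g := by
  rw [below_eq hh, Finset.sum_insert, Finset.sum_biUnion]
  · intro a _ b _ hab
    rw [Function.onFun, Finset.disjoint_left]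
    intro g hg hg'
    simp only [below, Finset.mem_filter] at hg hg'
    exact hab (eq_of_concat_prefix hg.2 hg'.2)
  · simp [below, not_concat_prefix_self]

/-- Backward induction, on the distance of the length of h from the maximal length of a history. -/
theorem tree_induction (G : GameTree N A) {P : List A → Prop}
    (ih : ∀ h ∈ G.H, (∀ a ∈ G.acts h, P (h ++ [a])) → P h) : ∀ h ∈ G.H, P h := by
  have key : ∀ n : ℕ, ∀ h ∈ G.H, G.H.sup List.length - h.length ≤ n → P h := by
    intro n
    induction n with
    | zero =>
      intro h hh hn
      refine ih h hh fun a ha => ?_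
      have := Finset.le_sup (f := List.length) (mem_acts.1 ha)
      simp only [List.length_append, List.length_singleton] at this
      omega
    | succ n ihn =>
      intro h hh hn
      refine ih h hh fun a ha => ihn _ (mem_acts.1 ha) ?_
      have := Finset.le_sup (f := List.length) (mem_acts.1 ha)
      simp only [List.length_append, List.length_singleton] at this ⊢
      omega
  exact fun h hh => key _ h hh le_rfl

/-- The expected payoff `f` when play starts at `h`. -/
def payoff (G : GameTree N A) (f : List A → ℝ) (σ : N → List A → A → ℝ) (h : List A) : ℝ :=
  ∑ z ∈ G.terminals.filter (fun z => h <+: z), f z * G.reach σ h z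

theorem payoff_eq_sum_below (f : List A → ℝ) (σ : N → List A → A → ℝ) (h : List A) :
    G.payoff f σ h = ∑ g ∈ G.below h, if G.acts g = ∅ then f g * G.reach σ h g else 0 := by
  rw [payoff, ← Finset.sum_filter]
  refine Finset.sum_congr ?_ fun _ _ => rfl
  ext z
  simp only [terminals, below, Finset.mem_filter]
  tauto

theorem payoff_step (f : List A → ℝ) (σ : N → List A → A → ℝ) {h : List A} (hh : h ∈ G.H)
    (hn : (G.acts h).Nonempty) :
    G.payoff f σ h = ∑ a ∈ G.acts h, G.prob σ h a * G.payoff f σ (h ++ [a]) := by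
  rw [payoff_eq_sum_below, sum_below _ hh, if_neg hn.ne_empty, zero_add]
  refine Finset.sum_congr rfl fun a _ => ?_
  rw [payoff_eq_sum_below, Finset.mul_sum]
  refine Finset.sum_congr rfl fun g hg => ?_
  split_ifs
  · rw [reach_step σ (Finset.mem_filter.1 hg).2]; ring
  · simp

theorem payoff_terminal (f : List A → ℝ) (σ : N → List A → A → ℝ) {h : List A} (hh : h ∈ G.H)
    (hn : G.acts h = ∅) : G.payoff f σ h = f h := by
  rw [payoff_eq_sum_below, sum_below _ hh, if_pos hn, hn, reach_self]
  simp

theorem value_eq_payoff (i : N) (σ : N → List A → A → ℝ) :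
    G.value i σ = G.payoff (G.u i) σ [] := by
  simp [value, payoff]

/-- At every nonterminal history `σ` induces a probability distribution over actions. -/
def Stochastic (G : GameTree N A) (σ : N → List A → A → ℝ) : Prop :=
  ∀ h ∈ G.H, (G.acts h).Nonempty →
    (∀ a ∈ G.acts h, 0 ≤ G.prob σ h a) ∧ ∑ a ∈ G.acts h, G.prob σ h a = 1

theorem Stochastic.prob_nonneg {σ : N → List A → A → ℝ} (hσ : G.Stochastic σ) {g : List A} {a : A}
    (h : g ++ [a] ∈ G.H) : 0 ≤ G.prob σ g a :=
  (hσ g (G.prefix_closed _ _ h) ⟨a, mem_acts.2 h⟩).1 a (mem_acts.2 h)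

theorem Stochastic.reach_nonneg {σ : N → List A → A → ℝ} (hσ : G.Stochastic σ) {h z : List A}
    (hz : h <+: z) (hzH : z ∈ G.H) : 0 ≤ G.reach σ h z := by
  rw [reach_eq_pathProd]
  exact pathProd_nonneg hz fun g a _ hg => hσ.prob_nonneg (G.prefix_mem hg hzH)

theorem Stochastic.reachOpp_nonneg {σ : N → List A → A → ℝ} (hσ : G.Stochastic σ) (i : N)
    {h z : List A} (hz : h <+: z) (hzH : z ∈ G.H) : 0 ≤ G.reachOpp σ i h z := by
  rw [reachOpp_eq_pathProd]
  refine pathProd_nonneg hz fun g a _ hg => ?_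
  split_ifs
  · exact zero_le_one
  · exact hσ.prob_nonneg (G.prefix_mem hg hzH)

/-- With c = 1 this is the total mass of play below h, the source of all later bounds on reach
probabilities. -/
theorem Stochastic.payoff_const {σ : N → List A → A → ℝ} (hσ : G.Stochastic σ) (c : ℝ) :
    ∀ h ∈ G.H, G.payoff (fun _ => c) σ h = c := by
  refine G.tree_induction (P := fun h => G.payoff (fun _ => c) σ h = c) ?_
  intro h hh ih
  by_cases hn : (G.acts h).Nonempty
  · rw [payoff_step _ _ hh hn, Finset.sum_congr rfl fun a ha => by rw [ih a ha],
      ← Finset.sum_mul, (hσ h hh hn).2, one_mul]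
  · exact payoff_terminal _ _ hh (Finset.not_nonempty_iff_eq_empty.1 hn)

theorem Stochastic.payoff_mono {σ : N → List A → A → ℝ} (hσ : G.Stochastic σ) {f f' : List A → ℝ}
    (hf : ∀ z ∈ G.terminals, f z ≤ f' z) (h : List A) :
    G.payoff f σ h ≤ G.payoff f' σ h := by
  refine Finset.sum_le_sum fun z hz => ?_
  obtain ⟨hz, hp⟩ := Finset.mem_filter.1 hz
  exact mul_le_mul_of_nonneg_right (hf z hz)
    (hσ.reach_nonneg hp (Finset.mem_filter.1 hz).1)

theorem mem_nodes {i : N} {h : List A} :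
    h ∈ G.nodes i ↔ h ∈ G.H ∧ (G.acts h).Nonempty ∧ G.turn h = some i := by
  simp [nodes]

theorem prob_of_turn {σ : N → List A → A → ℝ} {i : N} {h : List A} (hh : G.turn h = some i)
    (a : A) : G.prob σ h a = σ i h a := by
  simp [prob, hh]

theorem prob_congr {σ σ' : N → List A → A → ℝ} {i : N} (h : ∀ j, j ≠ i → σ j = σ' j)
    {g : List A} (hg : G.turn g ≠ some i) (a : A) : G.prob σ g a = G.prob σ' g a := by
  unfold prob
  split
  · rfl
  · next j hj => rw [h j (by rintro rfl; exact hg hj)]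

/-- The gain from `σ` to `σ'`, which differ for player `i` only, as a sum of local gains. -/
theorem payoff_sub_payoff (f : List A → ℝ) {σ σ' : N → List A → A → ℝ} {i : N}
    (hσ : ∀ j, j ≠ i → σ j = σ' j) :
    ∀ h ∈ G.H, G.payoff f σ' h - G.payoff f σ h =
      ∑ g ∈ G.below h, if g ∈ G.nodes i then G.reach σ' h g *
        ((∑ a ∈ G.acts g, σ' i g a * G.payoff f σ (g ++ [a])) - G.payoff f σ g) else 0 := by
  refine G.tree_induction (P := fun h => G.payoff f σ' h - G.payoff f σ h =
      ∑ g ∈ G.below h, if g ∈ G.nodes i then G.reach σ' h g *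
        ((∑ a ∈ G.acts g, σ' i g a * G.payoff f σ (g ++ [a])) - G.payoff f σ g) else 0) ?_
  intro h hh ih
  rw [sum_below _ hh, reach_self, one_mul]
  have hsum : ∑ a ∈ G.acts h, ∑ g ∈ G.below (h ++ [a]), (if g ∈ G.nodes i then G.reach σ' h g *
        ((∑ b ∈ G.acts g, σ' i g b * G.payoff f σ (g ++ [b])) - G.payoff f σ g) else 0) =
      ∑ a ∈ G.acts h, G.prob σ' h a *
        (G.payoff f σ' (h ++ [a]) - G.payoff f σ (h ++ [a])) := by
    refine Finset.sum_congr rfl fun a ha => ?_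
    rw [ih a ha, Finset.mul_sum]
    refine Finset.sum_congr rfl fun g hg => ?_
    split_ifs
    · rw [reach_step σ' (Finset.mem_filter.1 hg).2]; ring
    · simp
  rw [hsum]
  by_cases hn : (G.acts h).Nonempty
  -- At a node of player i, the value of one deviating step followed by σ is added and subtracted.
  -- At other nodes both profiles use the same probabilities, so only the gains further down remain.
  · simp only [mul_sub, Finset.sum_sub_distrib, ← payoff_step f σ' hh hn]
    by_cases hi : G.turn h = some i
    · rw [if_pos (mem_nodes.2 ⟨hh, hn, hi⟩)]
      simp only [prob_of_turn hi]
      ring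
    · rw [if_neg (fun h' => hi (mem_nodes.1 h').2.2)]
      simp only [← prob_congr hσ hi, ← payoff_step f σ hh hn]
      ring
  · have h0 := Finset.not_nonempty_iff_eq_empty.1 hn
    rw [payoff_terminal _ _ hh h0, payoff_terminal _ _ hh h0, h0,
      if_neg (fun h' => hn (mem_nodes.1 h').2.1)]
    simp

/-! ### Information sets and counterfactual values -/

/-- No element of `I` is a proper prefix of another one. -/
def PrefixFree (I : Finset (List A)) : Prop := ∀ h ∈ I, ∀ h' ∈ I, h <+: h' → h = h'

theorem PrefixFree.mono {I J : Finset (List A)} (hI : PrefixFree I) (hJ : J ⊆ I) :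
    PrefixFree J := fun h hh h' hh' => hI h (hJ hh) h' (hJ hh')

theorem Info.subset_nodes (𝓘 : G.Info) {i : N} {I : Finset (List A)} (hI : I ∈ 𝓘.sets i) :
    I ⊆ G.nodes i := (𝓘.part i).le hI

theorem Info.mem_H (𝓘 : G.Info) {i : N} {I : Finset (List A)} (hI : I ∈ 𝓘.sets i) {h : List A}
    (hh : h ∈ I) : h ∈ G.H := (mem_nodes.1 (𝓘.subset_nodes hI hh)).1

theorem Info.turn_eq (𝓘 : G.Info) {i : N} {I : Finset (List A)} (hI : I ∈ 𝓘.sets i) {h : List A}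
    (hh : h ∈ I) : G.turn h = some i := (mem_nodes.1 (𝓘.subset_nodes hI hh)).2.2

theorem Info.part_eq (𝓘 : G.Info) {i : N} {I : Finset (List A)} (hI : I ∈ 𝓘.sets i) {h : List A}
    (hh : h ∈ I) : (𝓘.part i).part h = I := (𝓘.part i).part_eq_of_mem hI hh

theorem Info.part_mem_sets (𝓘 : G.Info) {i : N} {h : List A} (hh : h ∈ G.nodes i) :
    (𝓘.part i).part h ∈ 𝓘.sets i := (𝓘.part i).part_mem.2 hh

theorem Info.mem_part (𝓘 : G.Info) {i : N} {h : List A} (hh : h ∈ G.nodes i) :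
    h ∈ (𝓘.part i).part h := (𝓘.part i).mem_part hh

theorem Info.prefixFree (𝓘 : G.Info) {i : N} {I : Finset (List A)} (hI : I ∈ 𝓘.sets i) :
    PrefixFree I := by
  intro h hh h' hh' hp
  by_contra hne
  exact 𝓘.no_repeat i h (𝓘.subset_nodes hI hh) h' (𝓘.subset_nodes hI hh') hp hne
    (by rw [𝓘.part_eq hI hh, 𝓘.part_eq hI hh'])

theorem Info.actsAt_eq (𝓘 : G.Info) {i : N} {I : Finset (List A)} (hI : I ∈ 𝓘.sets i) {h : List A}
    (hh : h ∈ I) : G.actsAt I = G.acts h := by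
  ext a
  simp only [actsAt, Finset.mem_biUnion]
  constructor
  · rintro ⟨g, hg, ha⟩
    rwa [𝓘.acts_eq i I hI h hh g hg]
  · exact fun ha => ⟨h, hh, ha⟩

theorem Info.nonempty_of_mem (𝓘 : G.Info) {i : N} {I : Finset (List A)} (hI : I ∈ 𝓘.sets i) :
    I.Nonempty := (𝓘.part i).nonempty_of_mem_parts hI

theorem PrefixFree.eq_of_prefix {I : Finset (List A)} (hI : PrefixFree I) {h h' z : List A}
    (hh : h ∈ I) (hh' : h' ∈ I) (hz : h <+: z) (hz' : h' <+: z) : h = h' := by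
  rcases List.prefix_or_prefix_of_prefix hz hz' with hp | hp
  · exact hI h hh h' hh' hp
  · exact (hI h' hh' h hh hp).symm

theorem PrefixFree.prefixIn_eq {I : Finset (List A)} (hI : PrefixFree I) {h z : List A}
    (hh : h ∈ I) (hz : h <+: z) : prefixIn I z = h := by
  unfold prefixIn
  cases hf : z.inits.find? (fun h => h ∈ I) with
  | none =>
    rw [List.find?_eq_none] at hf
    exact absurd hh (by simpa using hf h ((List.mem_inits _ _).2 hz))
  | some g =>
    have h1 := List.find?_some hf
    have h2 := List.mem_of_find?_eq_some hf
    simp only [decide_eq_true_eq] at h1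
    exact hI.eq_of_prefix h1 hh ((List.mem_inits _ _).1 h2) hz

theorem mem_through {I : Finset (List A)} {z : List A} :
    z ∈ G.through I ↔ z ∈ G.terminals ∧ ∃ h ∈ I, h <+: z := by
  simp [through]

theorem PrefixFree.sum_through {I : Finset (List A)} (hI : PrefixFree I) (F : List A → ℝ) :
    ∑ z ∈ G.through I, F z = ∑ h ∈ I, ∑ z ∈ G.terminals.filter (fun z => h <+: z), F z := by
  rw [← Finset.sum_biUnion]
  · refine Finset.sum_congr ?_ fun _ _ => rfl
    ext z
    simp only [mem_through, Finset.mem_biUnion, Finset.mem_filter]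
    constructor
    · rintro ⟨hz, h, hh, hp⟩; exact ⟨h, hh, hz, hp⟩
    · rintro ⟨h, hh, hz, hp⟩; exact ⟨hz, h, hh, hp⟩
  · intro h hh h' hh' hne
    rw [Function.onFun, Finset.disjoint_left]
    intro z hz hz'
    exact hne (hI.eq_of_prefix hh hh' (Finset.mem_filter.1 hz).2 (Finset.mem_filter.1 hz').2)

/-- The counterfactual probability of `z` from `I`: player `i` plays to reach `I`. -/
def cfProb (G : GameTree N A) (i : N) (σ : N → List A → A → ℝ) (I : Finset (List A))
    (z : List A) : ℝ :=
  G.reachOpp σ i [] (prefixIn I z) * G.reach σ (prefixIn I z) z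

theorem cfValue_eq_sum_cfProb (i : N) (σ : N → List A → A → ℝ) (I : Finset (List A)) :
    G.cfValue i σ I = ∑ z ∈ G.through I, G.u i z * G.cfProb i σ I z := by
  simp only [cfValue, cfProb, mul_assoc]

theorem PrefixFree.sum_cfProb {I : Finset (List A)} (hI : PrefixFree I) (f : List A → ℝ)
    (i : N) (σ : N → List A → A → ℝ) :
    ∑ z ∈ G.through I, f z * G.cfProb i σ I z =
      ∑ h ∈ I, G.reachOpp σ i [] h * G.payoff f σ h := by
  rw [hI.sum_through]
  refine Finset.sum_congr rfl fun h hh => ?_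
  rw [payoff, Finset.mul_sum]
  refine Finset.sum_congr rfl fun z hz => ?_
  rw [cfProb, hI.prefixIn_eq hh (Finset.mem_filter.1 hz).2]
  ring

/-- The probability that everybody but player `i` plays to reach `I`. -/
def oppReach (G : GameTree N A) (i : N) (σ : N → List A → A → ℝ) (I : Finset (List A)) : ℝ :=
  ∑ h ∈ I, G.reachOpp σ i [] h

theorem oppReach_congr {σ σ' : N → List A → A → ℝ} {i : N} (h : ∀ j, j ≠ i → σ j = σ' j)
    (I : Finset (List A)) : G.oppReach i σ I = G.oppReach i σ' I := by
  simp only [oppReach, reachOpp_congr h]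

theorem Stochastic.oppReach_nonneg {σ : N → List A → A → ℝ} (hσ : G.Stochastic σ) (i : N)
    {I : Finset (List A)} (hI : I ⊆ G.H) : 0 ≤ G.oppReach i σ I :=
  Finset.sum_nonneg fun _ hh => hσ.reachOpp_nonneg i List.nil_prefix (hI hh)

theorem Stochastic.sum_cfProb_eq_oppReach {σ : N → List A → A → ℝ} (hσ : G.Stochastic σ)
    {I : Finset (List A)} (hI : PrefixFree I) (hIH : I ⊆ G.H) (i : N) :
    ∑ z ∈ G.through I, G.cfProb i σ I z = G.oppReach i σ I := by
  have := hI.sum_cfProb (G := G) (fun _ => 1) i σ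
  simp only [one_mul] at this
  rw [this, oppReach]
  refine Finset.sum_congr rfl fun h hh => ?_
  rw [hσ.payoff_const 1 h (hIH hh), mul_one]

theorem Stochastic.cfProb_nonneg {σ : N → List A → A → ℝ} (hσ : G.Stochastic σ)
    {I : Finset (List A)} (hI : PrefixFree I) (i : N) {z : List A} (hz : z ∈ G.through I) :
    0 ≤ G.cfProb i σ I z := by
  obtain ⟨hz, h, hh, hp⟩ := mem_through.1 hz
  have hzH := (Finset.mem_filter.1 hz).1
  rw [cfProb, hI.prefixIn_eq hh hp]
  exact mul_nonneg (hσ.reachOpp_nonneg i List.nil_prefix (G.prefix_mem hp hzH))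
    (hσ.reach_nonneg hp hzH)

/-- Prefix-freeness makes the events of passing through distinct elements of I disjoint. -/
theorem Stochastic.sum_reach_le_one {σ : N → List A → A → ℝ} (hσ : G.Stochastic σ)
    {I : Finset (List A)} (hI : PrefixFree I) (hIH : I ⊆ G.H) :
    ∑ h ∈ I, G.reach σ [] h ≤ 1 := by
  have h1 : ∑ h ∈ I, G.reach σ [] h = ∑ z ∈ G.through I, G.reach σ [] z := by
    rw [hI.sum_through]
    refine Finset.sum_congr rfl fun h hh => ?_
    have h2 := hσ.payoff_const 1 h (hIH hh)
    rw [payoff] at h2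
    simp only [one_mul] at h2
    rw [← mul_one (G.reach σ [] h), ← h2, Finset.mul_sum]
    refine Finset.sum_congr rfl fun z hz => ?_
    exact (reach_trans σ List.nil_prefix (Finset.mem_filter.1 hz).2).symm
  have h3 := hσ.payoff_const 1 [] G.root_mem
  simp only [payoff, one_mul, List.nil_prefix, Finset.filter_true] at h3
  rw [h1, ← h3]
  refine Finset.sum_le_sum_of_subset_of_nonneg (Finset.filter_subset _ _) fun z hz _ => ?_
  exact hσ.reach_nonneg List.nil_prefix (Finset.mem_filter.1 hz).1

theorem switchTo_of_ne (σ : N → List A → A → ℝ) (i : N) (I : Finset (List A)) (a : A) (j : N)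
    (hj : j ≠ i) : switchTo σ i I a j = σ j := by
  simp [switchTo, hj]

theorem prob_switchTo_of_notMem (σ : N → List A → A → ℝ) (i : N) {I : Finset (List A)} (a : A)
    {g : List A} (hg : g ∉ I) (b : A) : G.prob (switchTo σ i I a) g b = G.prob σ g b := by
  by_cases hi : G.turn g = some i
  · rw [prob_of_turn hi, prob_of_turn hi]
    simp [switchTo, hg]
  · exact prob_congr (switchTo_of_ne σ i I a) hi b

theorem Info.prob_switchTo_of_mem (𝓘 : G.Info) (σ : N → List A → A → ℝ) {i : N}
    {I : Finset (List A)} (hI : I ∈ 𝓘.sets i) (a : A)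
    {g : List A} (hg : g ∈ I) (b : A) :
    G.prob (switchTo σ i I a) g b = if b = a then 1 else 0 := by
  rw [prob_of_turn (𝓘.turn_eq hI hg)]
  simp [switchTo, hg]

theorem PrefixFree.reach_switchTo {I : Finset (List A)} (hI : PrefixFree I)
    (σ : N → List A → A → ℝ) (i : N) (a : A) {h g z : List A} (hh : h ∈ I) (hg : h <+: g)
    (hne : h ≠ g) (hz : g <+: z) : G.reach (switchTo σ i I a) g z = G.reach σ g z := by
  simp only [reach_eq_pathProd]
  refine pathProd_congr hz fun g' b hg' _ => prob_switchTo_of_notMem _ _ _ ?_ _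
  intro hmem
  have h1 := hI h hh g' hmem (hg.trans hg')
  subst h1
  exact hne (hg.eq_of_length (le_antisymm hg.length_le hg'.length_le))

theorem ne_concat (h : List A) (a : A) : h ≠ h ++ [a] := by
  intro hh
  simpa using congrArg List.length hh

theorem Info.payoff_switchTo (𝓘 : G.Info) (f : List A → ℝ) (σ : N → List A → A → ℝ) {i : N}
    {I : Finset (List A)} (hI : I ∈ 𝓘.sets i) {h : List A} (hh : h ∈ I) {a : A}
    (ha : a ∈ G.acts h) :
    G.payoff f (switchTo σ i I a) h = G.payoff f σ (h ++ [a]) := by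
  rw [payoff_step _ _ (𝓘.mem_H hI hh) ⟨a, ha⟩]
  simp only [𝓘.prob_switchTo_of_mem σ hI a hh, ite_mul, one_mul, zero_mul,
    Finset.sum_ite_eq', ha, if_true]
  refine Finset.sum_congr rfl fun z hz => ?_
  rw [(𝓘.prefixFree hI).reach_switchTo σ i a hh (List.prefix_append _ _) (ne_concat _ _)
    (Finset.mem_filter.1 hz).2]

/-- The counterfactual regret at `J` for not having played `a`. -/
def regretAt (G : GameTree N A) (i : N) (σ : N → List A → A → ℝ) (J : Finset (List A))
    (a : A) : ℝ :=
  ∑ h ∈ J, G.reachOpp σ i [] h * (G.payoff (G.u i) σ (h ++ [a]) - G.payoff (G.u i) σ h)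

/-- The switch is made on the whole coarse set I although values are taken at J ⊆ I: the switched
profile then stays a profile of the coarse game, and play that has left h ∈ J does not meet I again.
-/
theorem Info.cfValue_switchTo_sub (𝓘 : G.Info) (σ : N → List A → A → ℝ) {i : N}
    {I J : Finset (List A)} (hI : I ∈ 𝓘.sets i) (hJ : J ⊆ I) {a : A} (ha : a ∈ G.actsAt I) :
    G.cfValue i (switchTo σ i I a) J - G.cfValue i σ J = G.regretAt i σ J a := by
  have hJf := (𝓘.prefixFree hI).mono hJ
  rw [cfValue_eq_sum_cfProb, cfValue_eq_sum_cfProb, hJf.sum_cfProb, hJf.sum_cfProb, regretAt,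
    ← Finset.sum_sub_distrib]
  refine Finset.sum_congr rfl fun h hh => ?_
  rw [𝓘.actsAt_eq hI (hJ hh)] at ha
  rw [𝓘.payoff_switchTo _ σ hI (hJ hh) ha, reachOpp_congr (switchTo_of_ne σ i I a)]
  ring

theorem Info.cfRegret_eq (𝓘 : G.Info) (σ : ℕ → N → List A → A → ℝ) (T : ℕ) {i : N}
    {I : Finset (List A)} (hI : I ∈ 𝓘.sets i) {a : A} (ha : a ∈ G.actsAt I) :
    G.cfRegret i σ T I a = ∑ t ∈ Finset.range T, G.regretAt i (σ t) I a :=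
  Finset.sum_congr rfl fun t _ => 𝓘.cfValue_switchTo_sub (σ t) hI subset_rfl ha

/-! ### Strategies -/

theorem Info.IsProfile.stochastic {𝓘 : G.Info} {σ : N → List A → A → ℝ} (hσ : 𝓘.IsProfile σ) :
    G.Stochastic σ := by
  intro h hh hn
  cases ht : G.turn h with
  | none =>
    simp only [prob, ht]
    refine ⟨fun a ha => G.chance_nonneg h hh ht a (mem_acts.1 ha), G.chance_sum h hh ht ?_⟩
    obtain ⟨a, ha⟩ := hn
    exact ⟨a, mem_acts.1 ha⟩
  | some j =>
    simp only [prob, ht]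
    exact (hσ j).1 h (mem_nodes.2 ⟨hh, hn, ht⟩)

/-- `s` is a probability distribution over the available actions wherever player `i` acts. -/
def IsBehavioral (G : GameTree N A) (i : N) (s : List A → A → ℝ) : Prop :=
  ∀ h ∈ G.nodes i, (∀ a ∈ G.acts h, 0 ≤ s h a) ∧ ∑ a ∈ G.acts h, s h a = 1

theorem Stochastic.update {σ : N → List A → A → ℝ} (hσ : G.Stochastic σ) {i : N}
    {s : List A → A → ℝ} (hs : G.IsBehavioral i s) : G.Stochastic (Function.update σ i s) := by
  intro h hh hn
  by_cases hi : G.turn h = some i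
  · simp only [prob_of_turn hi, Function.update_self]
    exact hs h (mem_nodes.2 ⟨hh, hn, hi⟩)
  · have : ∀ j, j ≠ i → σ j = Function.update σ i s j := fun j hj => by simp [hj]
    simp only [← prob_congr this hi]
    exact hσ h hh hn

theorem Info.isStrategy_switch (𝓘 : G.Info) {i : N} {s : List A → A → ℝ}
    (hs : 𝓘.IsStrategy i s) {I : Finset (List A)} (hI : I ∈ 𝓘.sets i) {a : A}
    (ha : a ∈ G.actsAt I) :
    𝓘.IsStrategy i (fun h b => if h ∈ I then (if b = a then 1 else 0) else s h b) := by
  refine ⟨fun h hh => ?_, fun K hK h hh h' hh' b hb => ?_⟩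
  · by_cases hm : h ∈ I
    · simp only [hm, if_true]
      refine ⟨fun b _ => by split_ifs <;> norm_num, ?_⟩
      rw [𝓘.actsAt_eq hI hm] at ha
      simp [ha]
    · simpa only [hm, if_false] using hs.1 h hh
  · have : h ∈ I ↔ h' ∈ I := by
      have key : ∀ g ∈ K, g ∈ I ↔ K = I := fun g hg =>
        ⟨fun hgI => by rw [← 𝓘.part_eq hK hg, 𝓘.part_eq hI hgI], fun e => e ▸ hg⟩
      rw [key h hh, key h' hh']
    simp only [this]
    rw [hs.2 K hK h hh h' hh' b hb]

theorem Info.IsProfile.switchTo {𝓘 : G.Info} {σ : N → List A → A → ℝ} (hσ : 𝓘.IsProfile σ)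
    {i : N} {I : Finset (List A)} (hI : I ∈ 𝓘.sets i) {a : A} (ha : a ∈ G.actsAt I) :
    𝓘.IsProfile (switchTo σ i I a) := by
  intro j
  by_cases hj : j = i
  · subst hj
    simp only [GameTree.switchTo, Function.update_self]
    exact 𝓘.isStrategy_switch (hσ j) hI ha
  · rw [switchTo_of_ne _ _ _ _ _ hj]
    exact hσ j

/-! ### Comparison of two sets of the refinement -/

/-- The probability of action `a` at the information set `K`. -/
def setProb (G : GameTree N A) (σ : N → List A → A → ℝ) (K : Finset (List A)) (a : A) : ℝ :=
  if h : K.Nonempty then G.prob σ h.choose a else 0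

theorem Info.IsProfile.prob_eq_setProb {𝓘 : G.Info} {σ : N → List A → A → ℝ}
    (hσ : 𝓘.IsProfile σ) {j : N} {g : List A} (hg : g ∈ G.nodes j) {a : A} (ha : a ∈ G.acts g) :
    G.prob σ g a = G.setProb σ ((𝓘.part j).part g) a := by
  have hK := 𝓘.part_mem_sets hg
  have hne : ((𝓘.part j).part g).Nonempty := ⟨g, 𝓘.mem_part hg⟩
  rw [setProb, dif_pos hne, prob_of_turn (mem_nodes.1 hg).2.2,
    prob_of_turn (𝓘.turn_eq hK hne.choose_spec)]
  exact (hσ j).2 _ hK g (𝓘.mem_part hg) _ hne.choose_spec a ha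

/-- Probabilities are constant on information sets, so the product can be read off the sequence
alone. This turns equal sequences into equal probabilities. -/
theorem Info.IsProfile.prod_seqOf {𝓘 : G.Info} {σ : N → List A → A → ℝ}
    (hσ : 𝓘.IsProfile σ) (Q : N → Prop) [DecidablePred Q] {h z : List A} (hz : h <+: z)
    (hzH : z ∈ G.H) :
    ((𝓘.seqOf Q h z).map (fun p => G.setProb σ p.1 p.2)).prod =
      pathProd (fun g a => if ∃ j, G.turn g = some j ∧ Q j then G.prob σ g a else 1) h z := by
  have hmem : ∀ s ∈ decisions h z, s.1 ++ [s.2] ∈ G.H := fun s hs =>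
    G.prefix_mem (mem_decisions hz hs).2 hzH
  unfold Info.seqOf pathProd
  revert hmem
  induction decisions h z with
  | nil => simp
  | cons s l ih =>
    intro hmem
    have ih := ih fun s hs => hmem s (List.mem_cons_of_mem _ hs)
    have hs := hmem s List.mem_cons_self
    simp only [List.map_cons, List.prod_cons, ← ih]
    cases ht : G.turn s.1 with
    | none => simp [ht]
    | some j =>
      by_cases hQ : Q j
      · simp only [List.filterMap_cons, ht, hQ, if_true, List.map_cons, List.prod_cons,
          Option.some.injEq, exists_eq_left']
        rw [hσ.prob_eq_setProb (j := j) _ (mem_acts.2 hs)]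
        exact mem_nodes.2 ⟨G.prefix_closed _ _ hs, ⟨_, mem_acts.2 hs⟩, ht⟩
      · simp [ht, hQ]

/-- The factors of chance and the opponents before and after J merge into factors along all of z, so
what remains is exactly the data that skew well-formedness compares. -/
theorem Info.IsProfile.cfProb_eq {𝓘 : G.Info} {σ : N → List A → A → ℝ} (hσ : 𝓘.IsProfile σ)
    (i : N) {J : Finset (List A)} (hJ : PrefixFree J) {z : List A} (hz : z ∈ G.through J) :
    G.cfProb i σ J z = G.chanceProb z *
      ((𝓘.oppSeq i [] z).map (fun p => G.setProb σ p.1 p.2)).prod *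
      ((𝓘.ownSeq i (prefixIn J z) z).map (fun p => G.setProb σ p.1 p.2)).prod := by
  obtain ⟨hz, h, hh, hp⟩ := mem_through.1 hz
  have hzH := (Finset.mem_filter.1 hz).1
  rw [cfProb, hJ.prefixIn_eq hh hp, Info.oppSeq, Info.ownSeq, hσ.prod_seqOf _ List.nil_prefix hzH,
    hσ.prod_seqOf _ hp hzH, reach_eq_own_mul_opp σ i, mul_left_comm, ← mul_assoc, mul_assoc _ _
    (G.reachOpp σ i h z), ← reachOpp_trans σ i List.nil_prefix hp, mul_comm, playProb_eq_pathProd]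
  congr 1
  · rw [chanceProb, prod_map_filter_eq, reachOpp_eq_pathProd]
    change _ = pathProd (fun g a => if decide (G.turn g = none) then G.chance g a else 1) [] z * _
    rw [← pathProd_mul]
    congr 1
    ext g a
    cases ht : G.turn g with
    | none => simp [prob, ht]
    | some j => by_cases hj : j = i <;> simp [hj]
  · congr 1
    ext g a
    congr 1
    simp

theorem Info.mem_refined {𝓙 : G.Info} {i : N} {I J : Finset (List A)} :
    J ∈ 𝓙.refined i I ↔ J ∈ 𝓙.sets i ∧ J ⊆ I := by
  simp [Info.refined]

section Skew

variable {𝓘 𝓙 : G.Info} {k δ ℓ : Finset (List A) → Finset (List A) → ℝ} {i : N}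
  {I J J' : Finset (List A)} {σ : N → List A → A → ℝ}

theorem Info.IsSkewWellFormed.exists_map (hskew : 𝓘.IsSkewWellFormed 𝓙 k δ ℓ)
    (hI : I ∈ 𝓘.sets i) (hJ : J ∈ 𝓙.refined i I) (hJ' : J' ∈ 𝓙.refined i I)
    (hσ : 𝓘.IsProfile σ) :
    ∃ φ : List A → List A,
      Set.BijOn φ (G.through J : Set (List A)) (G.through J' : Set (List A)) ∧
      ∀ z ∈ G.through J, |G.u i z - k J J' * G.u i (φ z)| ≤ δ J J' ∧
        G.cfProb i σ J z = ℓ J J' * G.cfProb i σ J' (φ z) := by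
  obtain ⟨-, -, -, φ, hφ, h⟩ := hskew.2 i I hI J hJ J' hJ'
  refine ⟨φ, hφ, fun z hz => ⟨(h z hz).1, ?_⟩⟩
  obtain ⟨-, h2, h3, h4⟩ := h z hz
  rw [hσ.cfProb_eq i (𝓙.prefixFree (Info.mem_refined.1 hJ).1) hz,
    hσ.cfProb_eq i (𝓙.prefixFree (Info.mem_refined.1 hJ').1) (hφ.mapsTo hz), h2, h3, h4]
  ring

/-- Play after each element of J has mass one, so the opponents' reach is the total counterfactual
probability on Z_J, which φ rescales term by term. -/
theorem Info.IsSkewWellFormed.oppReach_eq (hskew : 𝓘.IsSkewWellFormed 𝓙 k δ ℓ)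
    (hI : I ∈ 𝓘.sets i) (hJ : J ∈ 𝓙.refined i I) (hJ' : J' ∈ 𝓙.refined i I)
    (hσ : 𝓘.IsProfile σ) : G.oppReach i σ J = ℓ J J' * G.oppReach i σ J' := by
  obtain ⟨φ, hφ, h⟩ := hskew.exists_map hI hJ hJ' hσ
  have hJ := (Info.mem_refined.1 hJ).1
  have hJ' := (Info.mem_refined.1 hJ').1
  rw [← hσ.stochastic.sum_cfProb_eq_oppReach (𝓙.prefixFree hJ) (fun _ => 𝓙.mem_H hJ),
    ← hσ.stochastic.sum_cfProb_eq_oppReach (𝓙.prefixFree hJ') (fun _ => 𝓙.mem_H hJ'),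
    Finset.mul_sum]
  exact Finset.sum_nbij φ hφ.mapsTo hφ.injOn hφ.surjOn fun z hz => (h z hz).2

theorem Info.IsSkewWellFormed.abs_cfValue_sub_le (hskew : 𝓘.IsSkewWellFormed 𝓙 k δ ℓ)
    (hI : I ∈ 𝓘.sets i) (hJ : J ∈ 𝓙.refined i I) (hJ' : J' ∈ 𝓙.refined i I)
    (hσ : 𝓘.IsProfile σ) :
    |G.cfValue i σ J - k J J' * ℓ J J' * G.cfValue i σ J'| ≤
      δ J J' * ℓ J J' * G.oppReach i σ J' := by
  obtain ⟨φ, hφ, h⟩ := hskew.exists_map hI hJ hJ' hσ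
  obtain ⟨-, -, hℓ, -⟩ := hskew.2 i I hI J hJ J' hJ'
  have hJ' := (Info.mem_refined.1 hJ').1
  have hsum : ∀ F : List A → ℝ, ∑ z ∈ G.through J, F (φ z) = ∑ z ∈ G.through J', F z :=
    fun F => Finset.sum_nbij φ hφ.mapsTo hφ.injOn hφ.surjOn fun z _ => rfl
  rw [← hσ.stochastic.sum_cfProb_eq_oppReach (𝓙.prefixFree hJ') (fun _ => 𝓙.mem_H hJ'),
    cfValue_eq_sum_cfProb, cfValue_eq_sum_cfProb, ← hsum, ← hsum, Finset.mul_sum, Finset.mul_sum,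
    ← Finset.sum_sub_distrib]
  refine (Finset.abs_sum_le_sum_abs _ _).trans (Finset.sum_le_sum fun z hz => ?_)
  have hp := hσ.stochastic.cfProb_nonneg (𝓙.prefixFree hJ') i (hφ.mapsTo hz)
  rw [(h z hz).2]
  have : G.u i z * (ℓ J J' * G.cfProb i σ J' (φ z)) -
      k J J' * ℓ J J' * (G.u i (φ z) * G.cfProb i σ J' (φ z)) =
      (G.u i z - k J J' * G.u i (φ z)) * (ℓ J J' * G.cfProb i σ J' (φ z)) := by ring
  rw [this, abs_mul, abs_of_nonneg (mul_nonneg hℓ hp), mul_assoc]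
  exact mul_le_mul_of_nonneg_right (h z hz).1 (mul_nonneg hℓ hp)

/-- A regret is a difference of two counterfactual values, each with its own error; hence the 2.
Switching the action of player i leaves the opponents' reach unchanged. -/
theorem Info.IsSkewWellFormed.abs_regretAt_sub_le (hskew : 𝓘.IsSkewWellFormed 𝓙 k δ ℓ)
    (hI : I ∈ 𝓘.sets i) (hJ : J ∈ 𝓙.refined i I) (hJ' : J' ∈ 𝓙.refined i I)
    (hσ : 𝓘.IsProfile σ) {a : A} (ha : a ∈ G.actsAt I) :
    |G.regretAt i σ J a - k J J' * ℓ J J' * G.regretAt i σ J' a| ≤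
      2 * (δ J J' * ℓ J J') * G.oppReach i σ J' := by
  rw [← 𝓘.cfValue_switchTo_sub σ hI (Info.mem_refined.1 hJ).2 ha,
    ← 𝓘.cfValue_switchTo_sub σ hI (Info.mem_refined.1 hJ').2 ha]
  have h1 := hskew.abs_cfValue_sub_le hI hJ hJ' hσ
  have h2 := hskew.abs_cfValue_sub_le hI hJ hJ' (hσ.switchTo hI ha)
  rw [oppReach_congr (switchTo_of_ne σ i I a)] at h2
  rw [abs_le] at *
  constructor <;> linarith [h1.1, h1.2, h2.1, h2.2]

end Skew

/-! ### Bounds by the range of the utilities -/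

theorem Stochastic.terminals_nonempty {σ : N → List A → A → ℝ} (hσ : G.Stochastic σ) :
    G.terminals.Nonempty := by
  by_contra hne
  have := hσ.payoff_const 1 [] G.root_mem
  rw [payoff, Finset.not_nonempty_iff_eq_empty.1 hne] at this
  simp at this

theorem sub_le_utilRange (i : N) {z z' : List A} (hz : z ∈ G.terminals) (hz' : z' ∈ G.terminals) :
    G.u i z - G.u i z' ≤ G.utilRange i :=
  le_csSup (Set.Finite.bddAbove ((Finset.finite_toSet _).image _))
    ⟨(z, z'), by simp [hz, hz'], rfl⟩

theorem Stochastic.utilRange_nonneg {σ : N → List A → A → ℝ} (hσ : G.Stochastic σ) (i : N) :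
    0 ≤ G.utilRange i := by
  obtain ⟨z, hz⟩ := hσ.terminals_nonempty
  simpa using sub_le_utilRange i hz hz

theorem Stochastic.abs_payoff_sub_le {σ : N → List A → A → ℝ} (hσ : G.Stochastic σ) (i : N)
    {h h' : List A} (hh : h ∈ G.H) (hh' : h' ∈ G.H) :
    |G.payoff (G.u i) σ h - G.payoff (G.u i) σ h'| ≤ G.utilRange i := by
  obtain ⟨M, hM, hM'⟩ := G.terminals.exists_max_image (G.u i) hσ.terminals_nonempty
  obtain ⟨m, hm, hm'⟩ := G.terminals.exists_min_image (G.u i) hσ.terminals_nonempty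
  have hr := sub_le_utilRange i hM hm
  have key : ∀ g ∈ G.H, G.u i m ≤ G.payoff (G.u i) σ g ∧ G.payoff (G.u i) σ g ≤ G.u i M := by
    intro g hg
    constructor
    · rw [← hσ.payoff_const (G.u i m) g hg]
      exact hσ.payoff_mono hm' g
    · rw [← hσ.payoff_const (G.u i M) g hg]
      exact hσ.payoff_mono hM' g
  rw [abs_le]
  constructor <;> linarith [key h hh, key h' hh']

theorem Info.abs_regretAt_le (𝓙 : G.Info) {σ : N → List A → A → ℝ} (hσ : G.Stochastic σ) {i : N}
    {J : Finset (List A)} (hJ : J ∈ 𝓙.sets i) {a : A} (ha : a ∈ G.actsAt J) :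
    |G.regretAt i σ J a| ≤ G.utilRange i * G.oppReach i σ J := by
  rw [regretAt, oppReach, Finset.mul_sum]
  refine (Finset.abs_sum_le_sum_abs _ _).trans (Finset.sum_le_sum fun h hh => ?_)
  have hhH := 𝓙.mem_H hJ hh
  rw [𝓙.actsAt_eq hJ hh] at ha
  have h0 := hσ.reachOpp_nonneg i List.nil_prefix hhH
  rw [abs_mul, abs_of_nonneg h0, mul_comm]
  exact mul_le_mul_of_nonneg_right (hσ.abs_payoff_sub_le i (mem_acts.1 ha) hhH) h0

/-! ### Regret matching -/

theorem sq_max_add_le (x r : ℝ) : max (x + r) 0 ^ 2 ≤ max x 0 ^ 2 + 2 * (max x 0 * r) + r ^ 2 := by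
  have h : max (x + r) 0 ≤ |max x 0 + r| := by
    apply max_le
    · exact (add_le_add_left (le_max_left x 0) r).trans (le_abs_self _)
    · exact abs_nonneg _
  calc max (x + r) 0 ^ 2 ≤ |max x 0 + r| ^ 2 := pow_le_pow_left₀ (le_max_right _ _) h 2
    _ = _ := by rw [sq_abs]; ring

/-- Blackwell's potential argument: the next strategy is proportional to the positive parts of the
regrets, so the cross term is a multiple of the average regret and vanishes. If no regret is
positive, the cross term is zero for any strategy. -/
theorem regret_matching {A : Type*} {B : Finset A} {r p : ℕ → A → ℝ}
    (hp : ∀ t, ∀ a ∈ B, p t a =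
      if ∑ b ∈ B, max (∑ s ∈ Finset.range t, r s b) 0 = 0 then 1 / (B.card : ℝ)
      else max (∑ s ∈ Finset.range t, r s a) 0 / ∑ b ∈ B, max (∑ s ∈ Finset.range t, r s b) 0)
    (hr : ∀ t, ∑ a ∈ B, p t a * r t a = 0) (T : ℕ) :
    ∑ a ∈ B, max (∑ t ∈ Finset.range T, r t a) 0 ^ 2 ≤
      ∑ t ∈ Finset.range T, ∑ a ∈ B, r t a ^ 2 := by
  induction T with
  | zero => simp
  | succ T ih =>
    simp only [Finset.sum_range_succ]
    have hzero : ∑ a ∈ B, max (∑ s ∈ Finset.range T, r s a) 0 * r T a = 0 := by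
      by_cases h0 : ∑ b ∈ B, max (∑ s ∈ Finset.range T, r s b) 0 = 0
      · rw [Finset.sum_eq_zero_iff_of_nonneg fun _ _ => le_max_right _ _] at h0
        exact Finset.sum_eq_zero fun a ha => by rw [h0 a ha, zero_mul]
      · have := hr T
        rw [Finset.sum_congr rfl fun a ha => by rw [hp T a ha, if_neg h0, div_mul_eq_mul_div],
          ← Finset.sum_div] at this
        exact (div_eq_zero_iff.1 this).resolve_right h0
    calc _ ≤ ∑ a ∈ B, (max (∑ s ∈ Finset.range T, r s a) 0 ^ 2 +
          2 * (max (∑ s ∈ Finset.range T, r s a) 0 * r T a) + r T a ^ 2) :=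
          Finset.sum_le_sum fun a _ => sq_max_add_le _ _
      _ ≤ _ := by
        rw [Finset.sum_add_distrib, Finset.sum_add_distrib, ← Finset.mul_sum, hzero]
        linarith

/-- The bound b may vary with the round; it will be proportional to the reach probability in that
round. -/
theorem le_of_regret_matching {A : Type*} {B : Finset A} {r p : ℕ → A → ℝ}
    (hp : ∀ t, ∀ a ∈ B, p t a =
      if ∑ b ∈ B, max (∑ s ∈ Finset.range t, r s b) 0 = 0 then 1 / (B.card : ℝ)
      else max (∑ s ∈ Finset.range t, r s a) 0 / ∑ b ∈ B, max (∑ s ∈ Finset.range t, r s b) 0)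
    (hr : ∀ t, ∑ a ∈ B, p t a * r t a = 0) (T : ℕ) {b : ℕ → ℝ}
    (hb : ∀ t, ∀ a ∈ B, |r t a| ≤ b t) {a : A} (ha : a ∈ B) :
    ∑ t ∈ Finset.range T, r t a ≤
      √(B.card : ℝ) * √(∑ t ∈ Finset.range T, b t ^ 2) := by
  rw [← Real.sqrt_mul (Nat.cast_nonneg _)]
  refine (le_max_left _ 0).trans (Real.le_sqrt_of_sq_le ?_)
  refine (Finset.single_le_sum (f := fun a => max (∑ t ∈ Finset.range T, r t a) 0 ^ 2)
    (fun _ _ => sq_nonneg _) ha).trans ((regret_matching hp hr T).trans ?_)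
  rw [Finset.mul_sum]
  refine Finset.sum_le_sum fun t _ => ?_
  rw [← nsmul_eq_mul]
  refine Finset.sum_le_card_nsmul _ _ _ fun a ha => ?_
  rw [← sq_abs]
  exact pow_le_pow_left₀ (abs_nonneg _) (hb t a ha) 2

/-! ### Comparing the regrets at the parts of an information set -/

section Scalar

variable {c q η Z X x y Q K Δ : ℝ}

/-- In this section x and q are the regret and reach of the part j under study, and ρ, Q, b belong
to another part. Two lower bounds for ρ, one from each direction of the comparison with j, are
mixed. -/
theorem cost_le_of_lt {κ κ' ρ b : ℝ} (hη : 0 ≤ η) (hK : 1 ≤ K)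
    (hq : 0 ≤ q) (hκ : 0 ≤ κ) (hκK : κ ≤ K) (h1 : x ≤ κ * ρ + Q)
    (h2 : κ' * x - q ≤ ρ) (hb : b ≤ (κ' * Δ + 1) * q) (hΔ : 0 ≤ Δ) (hx : x ≤ Δ * q)
    (hZ : q < x - K * (η * (Δ * q))) (hQ : Q < x) :
    η * b - ρ ≤ η * (2 * q - (x - K * (η * (Δ * q)))) +
      (1 - η) * max (Q - (x - K * (η * (Δ * q)))) 0 := by
  set y := η * (Δ * q) with hy
  have hyx : η * x ≤ y := mul_le_mul_of_nonneg_left hx hη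
  have hy0 : 0 ≤ y := by positivity
  have hKy : y ≤ K * y := le_mul_of_one_le_left hy0 hK
  have hx0 : 0 < x := by linarith
  have hρ : 0 < ρ := by
    by_contra hρ
    have := mul_nonpos_of_nonneg_of_nonpos hκ (not_lt.1 hρ)
    linarith
  have hKρ : x - Q ≤ K * ρ := by
    have := mul_le_mul_of_nonneg_right hκK hρ.le
    linarith
  have hηb : η * b ≤ κ' * y + η * q := by
    have := mul_le_mul_of_nonneg_left hb hη
    rw [hy]
    linarith
  have hX : q < x - y := by linarith
  set M := max (Q - (x - K * y)) 0 with hM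
  have hM0 : 0 ≤ M := le_max_right _ _
  have hM1 : Q - (x - K * y) ≤ M := le_max_left _ _
  -- the lower bound for `ρ` that comes from `K`
  have h3 : y - M ≤ ρ := by
    have : K * (y - M) ≤ K * ρ := by nlinarith
    exact le_of_mul_le_mul_left this (by linarith)
  -- The bounds ρ ≥ κ' x - q and ρ ≥ y - M are weighted by y and x - y; with these weights the
  -- unknown factor κ' cancels.
  have h4 : x * (η * b - ρ) ≤ x * (η * (2 * q - (x - K * y)) + (1 - η) * M) := by
    have e1 : y * (η * b - ρ) ≤ y * (κ' * y + η * q - (κ' * x - q)) :=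
      mul_le_mul_of_nonneg_left (by linarith) hy0
    have e2 : (x - y) * (η * b - ρ) ≤ (x - y) * (κ' * y + η * q - (y - M)) :=
      mul_le_mul_of_nonneg_left (by linarith) (by linarith)
    have e3 : (x - y) * M ≤ (1 - η) * x * M := mul_le_mul_of_nonneg_right (by linarith) hM0
    have e4 : η * x * (x - K * y - q) ≤ y * (x - y - q) :=
      mul_le_mul hyx (by linarith) (by linarith) hy0
    nlinarith
  exact le_of_mul_le_mul_left h4 hx0

/-- The comparison with j forces K ρ ≥ x - Q > K η Δ q, and Q ≤ q makes η b at most η Δ q: the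
regret of the part outweighs its range. -/
theorem cost_nonpos_of_le {κ ρ b : ℝ} (hη : 0 ≤ η) (hK : 1 ≤ K)
    (hκ : 0 ≤ κ) (hκK : κ ≤ K) (h1 : x ≤ κ * ρ + Q) (hb : b ≤ Δ * Q) (hΔ : 0 ≤ Δ)
    (hQ0 : 0 ≤ Q) (hQq : Q ≤ q) (hQ : Q < x - K * (η * (Δ * q))) : η * b - ρ ≤ 0 := by
  have hy : η * b ≤ η * (Δ * q) :=
    mul_le_mul_of_nonneg_left (hb.trans (mul_le_mul_of_nonneg_left hQq hΔ)) hη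
  have hy0 : 0 ≤ η * (Δ * q) := by have := hQ0.trans hQq; positivity
  have hKy : 0 ≤ K * (η * (Δ * q)) := by positivity
  have hρ : 0 < ρ := by
    by_contra hρ
    have := mul_nonpos_of_nonneg_of_nonpos hκ (not_lt.1 hρ)
    linarith
  have hKρ : K * (η * (Δ * q)) ≤ K * ρ := by
    have := mul_le_mul_of_nonneg_right hκK hρ.le
    linarith
  have := le_of_mul_le_mul_left hKρ (by linarith)
  linarith

/-- Weighting the two bounds by 1 + η and 1 - η gives 2X ≤ (1 - η²)(1 + c q). -/
theorem false_of_big_sibling (hη : 0 ≤ η) (hη1 : η ≤ 1) (hq : 0 ≤ q) (hc : 0 ≤ c)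
    (hZX : Z ≤ X) (hZ : 1 + c * q < 2 * Z) (h1 : X ≤ (1 - η) * (1 - q))
    (h2 : X ≤ (c + 1) * ((1 + η) * q)) : False := by
  have e1 := mul_le_mul_of_nonneg_left h1 (by linarith : 0 ≤ 1 + η)
  have e2 := mul_le_mul_of_nonneg_left h2 (by linarith : 0 ≤ 1 - η)
  have : 0 ≤ η ^ 2 * (1 + c * q) := by positivity
  nlinarith

/-- The constraints force q < 1/2 and η > 1/3, and then 4η² - 3η + 1 < 0, which has no real
solution. -/
theorem false_of_medium_sibling (hη : 0 ≤ η) (hc : 0 ≤ c) (hq : 0 ≤ q)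
    (hZ : 1 + c * q < 2 * Z) (h0 : Z ≤ 1 - η) (h1 : q ≤ 1 - Z)
    (h2 : Z ≤ c * ((1 + η) * q) + (η * (2 * q - Z) + (1 - η) * (1 - q - Z))) : False := by
  have e1 : c * q < 1 - 2 * η := by linarith
  have e2 : η * (1 - c * q) < q * (3 * η - 1) := by nlinarith
  have e3 : η * (2 * η) ≤ η * (1 - c * q) := mul_le_mul_of_nonneg_left (by linarith) hη
  have hcq : 0 ≤ c * q := by positivity
  have e4 : q < 1 / 2 := by linarith
  have e5 : 0 < 3 * η - 1 := by
    by_contra h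
    have := mul_nonpos_of_nonneg_of_nonpos hq (not_lt.1 h)
    nlinarith
  nlinarith [sq_nonneg (η - 3 / 8)]

/-- Eliminating Z leaves an affine function a + B q that must be positive at a point strictly
between 1/M and 1/(c + 2), yet is negative at the first endpoint and nonpositive at the second. -/
theorem false_of_all_small_with_sibling (hη : 0 ≤ η) (hη1 : η < 1) (hc : 0 ≤ c)
    (hZ : 1 + c * q < 2 * Z) (h0 : q ≤ 1 - Z)
    (h1 : Z ≤ (c + 1) * ((1 + η) * q))
    (h2 : Z ≤ c * (η * (2 * q - Z) + (1 - η) * (1 - Z)) +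
      (η * (2 * q - Z) + (1 - η) * (1 - q - Z))) : False := by
  set B := (c + 1) * (2 * η - c / 2) - (1 - η) - c / 2 with hB
  set a := (c + 1) * (1 / 2 - η) - 1 / 2 with ha
  set M := c * (1 + 2 * η) + 2 + 2 * η with hM
  have e0 : q * (c + 2) < 1 := by linarith
  have e1 : 1 < q * M := by rw [hM]; linarith
  have e2 : 0 < a + B * q := by
    rw [ha, hB]
    have : (c + 2) * (1 + c * q) ≤ (c + 2) * (2 * Z) :=
      mul_le_mul_of_nonneg_left hZ.le (by linarith)
    nlinarith
  have n0 : a * M + B = -1 + η - 2 * η ^ 2 * (c + 1) ^ 2 := by rw [ha, hB, hM]; ring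
  have n1 : a * (c + 2) + B = -η * c * (c + 1) - 1 + η := by rw [ha, hB]; ring
  have e3 : (a + B * q) * (2 * η * (c + 1)) =
      (a * M + B) * (1 - q * (c + 2)) + (a * (c + 2) + B) * (q * M - 1) := by
    rw [hM]; ring
  have n0' : a * M + B < 0 := by rw [n0]; nlinarith [mul_nonneg (sq_nonneg η) (sq_nonneg (c + 1))]
  have n1' : a * (c + 2) + B ≤ 0 := by
    rw [n1]
    nlinarith [mul_nonneg (mul_nonneg hη hc) hc, mul_nonneg hη hc]
  have e4 : 0 ≤ (a + B * q) * (2 * η * (c + 1)) := by positivity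
  have e5 := mul_neg_of_neg_of_pos n0' (sub_pos.2 e0)
  have e6 := mul_nonpos_of_nonpos_of_nonneg n1' (sub_pos.2 e1).le
  linarith

/-- `m` elements of the support have a weight between `q` and `Z`. -/
theorem false_of_large_outside {m : ℕ} {c : ℕ} (hη : 0 ≤ η) (hη1 : η < 1) (hq : 0 ≤ q)
    (hc : 1 ≤ c) (hm : (m + 1) * q ≤ 1) (hm' : m = 0 ∨ (m + 1) * q < 1)
    (hZ : 1 + c * q < 2 * Z) (h0 : Z ≤ 1 - η)
    (h1 : Z ≤ c * ((1 + η) * q) + m * (η * max (2 * q - Z) 0)) : False := by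
  have hc' : (1 : ℝ) ≤ c := by exact_mod_cast hc
  -- The weights 1 + η and 1 - η again give 2Z ≤ (1 - η²)(1 + c q).
  have base : Z ≤ c * ((1 + η) * q) → False := by
    intro h
    have e1 := mul_le_mul_of_nonneg_left h0 (by linarith : 0 ≤ 1 + η)
    have e2 := mul_le_mul_of_nonneg_left h (by linarith : 0 ≤ 1 - η)
    have : 0 ≤ η ^ 2 * (1 + c * q) := by positivity
    nlinarith
  rcases le_or_gt (2 * q) Z with h2 | h2
  · rw [max_eq_right (by linarith)] at h1
    exact base (by simpa using h1)
  rcases hm' with rfl | hm'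
  · exact base (by simpa using h1)
  rw [max_eq_left (by linarith)] at h1
  have hm0 : m ≠ 0 := by
    rintro rfl
    exact base (by simpa using h1)
  have hm1 : (1 : ℝ) ≤ m := by exact_mod_cast Nat.one_le_iff_ne_zero.2 hm0
  -- With Z < 2q and m ≥ 1 the counting bounds leave only c = m = 1 and 1/3 < q < 1/2.
  have hq0 : 0 < q := by nlinarith
  have hq2 : q < 1 / 2 := by nlinarith
  have hc1 : c = 1 := by
    have : (c : ℝ) < 2 := by nlinarith
    have : c < 2 := by exact_mod_cast this
    omega
  subst hc1
  have hq3 : 1 / 3 < q := by norm_num at hZ; linarith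
  have hm2 : m = 1 := by
    have : (m : ℝ) < 2 := by nlinarith
    have : m < 2 := by exact_mod_cast this
    omega
  subst hm2
  norm_num at h1 hZ
  nlinarith

/-- `m` elements of the support have a weight between `q` and `Z`, and no weight exceeds the regret. -/
theorem false_of_all_small {m c : ℕ} (hη : 0 ≤ η) (hη1 : η < 1) (hq : 0 ≤ q) (hq1 : q ≤ 1)
    (hm : (m + 1) * q ≤ 1) (hZ : 1 + c * q < 2 * Z)
    (h1 : Z ≤ c * ((1 + η) * q) + m * (η * max (2 * q - Z) 0))
    (h2 : Z ≤ c * (η * (2 * q - Z) + (1 - η) * max (1 - Z) 0) +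
      m * (η * max (2 * q - Z) 0)) : False := by
  have hc0 : (0 : ℝ) ≤ c := Nat.cast_nonneg c
  have hm0 : (0 : ℝ) ≤ m := Nat.cast_nonneg m
  have hcq : 0 ≤ c * q := mul_nonneg hc0 hq
  rcases le_or_gt 1 Z with hZ1 | hZ1
  · rw [max_eq_right (by linarith : 1 - Z ≤ 0)] at h2
    have hm' : m * (η * max (2 * q - Z) 0) = 0 := by
      rcases le_or_gt (2 * q) Z with h | h
      · rw [max_eq_right (by linarith)]; simp
      · have : (m : ℝ) < 1 := by nlinarith
        have : m < 1 := by exact_mod_cast this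
        have : m = 0 := by omega
        simp [this]
    rw [hm'] at h2
    have e1 : (1 + c * η) * (1 + c * q) < 4 * (c * (η * q)) := by
      have : (1 + c * η) * (1 + c * q) < (1 + c * η) * (2 * Z) :=
        mul_lt_mul_of_pos_left hZ (by positivity)
      nlinarith
    have e2 : c * (η * q) ≤ c * q := mul_le_mul_of_nonneg_left (by nlinarith) hc0
    have e3 : c * (η * q) ≤ c * η := mul_le_mul_of_nonneg_left (by nlinarith) hc0
    have e4 : η * q ≤ 1 := by nlinarith
    have e5 : 0 ≤ η * q * (1 - c) ^ 2 := by positivity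
    nlinarith
  rw [max_eq_left (by linarith : 0 ≤ 1 - Z)] at h2
  rcases le_or_gt (m * (η * max (2 * q - Z) 0)) 0 with hm' | hm'
  · have h1 : Z ≤ c * ((1 + η) * q) := by linarith
    have h2 : Z ≤ c * (η * (2 * q - Z) + (1 - η) * (1 - Z)) := by linarith
    have hc1 : (1 : ℝ) ≤ c := by
      rcases Nat.eq_zero_or_pos c with rfl | h
      · norm_num at h1 hZ; linarith
      · exact_mod_cast h
    -- Again an affine function, now of p in the open interval from 1/(1 + 2η) to 1, with the wrong
    -- sign at both ends.
    set p := c * q with hp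
    have i1 : 1 < p * (1 + 2 * η) := by nlinarith
    have i2 : 0 < (c * (1 / 2 - η) - 1 / 2) + (2 * η - c / 2 - 1 / 2) * p := by
      have : c * (1 + p) ≤ c * (2 * Z) := mul_le_mul_of_nonneg_left hZ.le hc0
      nlinarith
    have i3 : p < 1 := by linarith
    have n0 : (c * (1 / 2 - η) - 1 / 2) * (1 + 2 * η) + (2 * η - c / 2 - 1 / 2) < 0 := by
      nlinarith [mul_nonneg hc0 (sq_nonneg η)]
    have n1 : (c * (1 / 2 - η) - 1 / 2) + (2 * η - c / 2 - 1 / 2) ≤ 0 := by nlinarith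
    have e5 := mul_neg_of_neg_of_pos n0 (sub_pos.2 i3)
    have e6 := mul_nonpos_of_nonpos_of_nonneg n1 (sub_pos.2 i1).le
    have e7 := mul_nonneg i2.le hη
    nlinarith
  · have hmpos : 0 < m := by
      rcases Nat.eq_zero_or_pos m with rfl | h
      · simp at hm'
      · exact h
    have h2q : Z < 2 * q := by
      by_contra h
      rw [max_eq_right (by linarith)] at hm'
      simp at hm'
    rw [max_eq_left (by linarith)] at h2
    -- Here 1/4 < q ≤ 1/2, so only m ∈ {1, 2} and c ∈ {0, 1} survive.
    have hm1 : (1 : ℝ) ≤ m := by exact_mod_cast hmpos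
    have hq2 : q ≤ 1 / 2 := by nlinarith
    have hq4 : 1 / 4 < q := by linarith
    have hm3 : m < 3 := by
      have : (m : ℝ) < 3 := by nlinarith
      exact_mod_cast this
    have hc2 : c < 2 := by
      have : (c : ℝ) < 2 := by nlinarith
      exact_mod_cast this
    interval_cases c <;> interval_cases m <;> norm_num at h2 hm hZ <;> nlinarith

end Scalar

/-- The regret `ρ j` at a part `j` of an information set with parts `P`, when the total regret is at
most `η` times the range `∑ b` and the regrets at `j` and at any other part agree up to factors
`κ`, `κ'` and an error proportional to the reach probabilities `Q`. The comparator reaches `S`. -/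
theorem scaled_regret_le {ι : Type*} [DecidableEq ι] {P S : Finset ι} (hS : S ⊆ P) {j : ι}
    (hj : j ∈ S) {Q ρ b κ κ' : ι → ℝ} {Δ η K : ℝ} (hΔ : 0 ≤ Δ) (hη : 0 ≤ η) (hK : 1 ≤ K)
    (hQ0 : ∀ k ∈ P, 0 ≤ Q k) (hQ1 : ∀ k ∈ P, Q k ≤ 1) (hQS : ∑ k ∈ S, Q k ≤ 1)
    (hκ : ∀ k ∈ P, 0 ≤ κ k ∧ κ k ≤ K) (hκ' : ∀ k ∈ P, 0 ≤ κ' k)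
    (h1 : ∀ k ∈ P, ρ j ≤ κ k * ρ k + Q k) (h2 : ∀ k ∈ P, κ' k * ρ j - Q j ≤ ρ k)
    (hx : ρ j ≤ Δ * Q j)
    (hb1 : ∀ k ∈ P, b k ≤ Δ * Q k) (hb2 : ∀ k ∈ P, b k ≤ (κ' k * Δ + 1) * Q j)
    (hreg : ∑ k ∈ P, ρ k ≤ η * ∑ k ∈ P, b k) :
    ρ j ≤ K * (η * (Δ * Q j)) + (1 + (P \ S).card * Q j) / 2 := by
  have hjP := hS hj
  set c := (P \ S).card with hc
  set q := Q j with hqdef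
  set x := ρ j with hxdef
  have hq0 : 0 ≤ q := hQ0 j hjP
  have hc0 : (0 : ℝ) ≤ c := Nat.cast_nonneg _
  have hcq : 0 ≤ c * q := mul_nonneg hc0 hq0
  have hΔq : 0 ≤ Δ * q := mul_nonneg hΔ hq0
  rcases le_or_gt 1 η with hη1 | hη1
  -- For η ≥ 1 the trivial bound Δ Q j on the regret is already enough.
  · have e1 : Δ * q ≤ η * (Δ * q) := le_mul_of_one_le_left hΔq hη1
    have e2 : η * (Δ * q) ≤ K * (η * (Δ * q)) := le_mul_of_one_le_left (by positivity) hK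
    linarith
  by_contra hcon
  set Z := x - K * (η * (Δ * q)) with hZdef
  set X := x - η * (Δ * q) with hXdef
  have hZ : 1 + c * q < 2 * Z := by linarith
  have hy0 : 0 ≤ η * (Δ * q) := by positivity
  have hZX : Z ≤ X := by
    have := le_mul_of_one_le_left hy0 hK
    linarith
  have hXx : X ≤ (1 - η) * x := by
    have := mul_le_mul_of_nonneg_left hx hη
    linarith
  have hZx : Z ≤ x := by linarith
  -- The cost of a part is its share of the regret-matching bound minus its regret. The costs sum to
  -- at least 0 and C j ≤ -X, so the other parts must supply X.
  set C : ι → ℝ := fun k => η * b k - ρ k with hC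
  -- bounds for single costs
  have hCA : ∀ k ∈ P, C k ≤ (1 + η) * q := by
    intro k hk
    have e1 := mul_le_mul_of_nonneg_left (hb2 k hk) hη
    have e2 := h2 k hk
    have e3 : 0 ≤ κ' k * X := mul_nonneg (hκ' k hk) (by linarith)
    simp only [hC]
    nlinarith
  have hCB : ∀ k ∈ P, Q k ≤ q → Q k < Z → C k ≤ 0 := fun k hk hkq hkZ =>
    cost_nonpos_of_le hη hK (hκ k hk).1 (hκ k hk).2 (h1 k hk) (hb1 k hk) hΔ (hQ0 k hk) hkq hkZ
  have hCC : q < Z → ∀ k ∈ P, Q k < x → C k ≤ η * (2 * q - Z) + (1 - η) * max (Q k - Z) 0 :=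
    fun hqZ k hk hkx => cost_le_of_lt hη hK hq0 (hκ k hk).1 (hκ k hk).2 (h1 k hk) (h2 k hk)
      (hb2 k hk) hΔ hx hqZ hkx
  have hsum : X ≤ ∑ k ∈ P \ S, C k + ∑ k ∈ S.erase j, C k := by
    have e1 : ∑ k ∈ P, C k = ∑ k ∈ P \ S, C k + (∑ k ∈ S.erase j, C k + C j) := by
      rw [Finset.sum_erase_add _ _ hj, Finset.sum_sdiff hS]
    have e2 : 0 ≤ ∑ k ∈ P, C k := by
      simp only [hC, Finset.sum_sub_distrib, ← Finset.mul_sum]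
      linarith
    have e3 := mul_le_mul_of_nonneg_left (hb1 j hjP) hη
    have e4 : C j = η * b j - x := rfl
    linarith
  have hQsum : ∑ k ∈ S.erase j, Q k + q ≤ 1 := by rwa [Finset.sum_erase_add _ _ hj]
  have hout : ∀ {B : ℝ}, (∀ k ∈ P \ S, C k ≤ B) → ∑ k ∈ P \ S, C k ≤ c * B := by
    intro B hB
    rw [← nsmul_eq_mul]
    exact Finset.sum_le_card_nsmul _ _ _ hB
  have hSP : ∀ k ∈ S.erase j, k ∈ P := fun k hk => hS (Finset.mem_of_mem_erase hk)
  have hle : ∀ k ∈ S.erase j, Q k + q ≤ 1 := fun k hk =>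
    (add_le_add_left (Finset.single_le_sum (f := Q) (fun l hl => hQ0 l (hSP l hl)) hk) q).trans
      hQsum
  -- If Z ≤ q, then 1 + c q < 2Z and q ≤ 1 force c = 0 and q > 1/2. Every other part is then in S
  -- with reach at most 1 - q < Z, so no other cost is positive.
  rcases le_or_gt Z q with hqZ | hqZ
  · have hc1 : c = 0 := by
      have : (c : ℝ) < 1 := by nlinarith [hQ1 j hjP]
      have : c < 1 := by exact_mod_cast this
      omega
    have e0 : P \ S = ∅ := Finset.card_eq_zero.1 hc1
    have e1 : ∑ k ∈ P \ S, C k = 0 := by rw [e0, Finset.sum_empty]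
    have e2 : ∑ k ∈ S.erase j, C k ≤ 0 := Finset.sum_nonpos fun k hk => by
      have := hle k hk
      exact hCB k (hSP k hk) (by linarith) (by linarith)
    linarith
  -- Only reached parts in T₁ or T₂ can have positive cost. Since Z > 1/2 and reach in S sums to at
  -- most 1, T₁ has at most one element.
  set T₁ := (S.erase j).filter (fun k => Z ≤ Q k) with hT₁
  set T₂ := (S.erase j).filter (fun k => q < Q k ∧ Q k < Z) with hT₂
  have hT₁S : T₁ ⊆ S.erase j := Finset.filter_subset _ _
  have hT₂S : T₂ ⊆ S.erase j := Finset.filter_subset _ _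
  have hdisj : Disjoint T₁ T₂ := by
    rw [Finset.disjoint_left]
    intro k hk hk'
    have e1 := (Finset.mem_filter.1 hk).2
    have e2 := (Finset.mem_filter.1 hk').2.2
    linarith
  have hin : ∑ k ∈ S.erase j, C k ≤ ∑ k ∈ T₁, C k + ∑ k ∈ T₂, C k := by
    rw [← Finset.sum_union hdisj, ← Finset.sum_sdiff (Finset.union_subset hT₁S hT₂S)]
    refine add_le_of_nonpos_left (Finset.sum_nonpos fun k hk => ?_)
    obtain ⟨hk1, hk2⟩ := Finset.mem_sdiff.1 hk
    have hkZ : Q k < Z := by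
      by_contra h
      exact hk2 (Finset.mem_union_left _ (Finset.mem_filter.2 ⟨hk1, not_lt.1 h⟩))
    refine hCB k (hSP k hk1) ?_ hkZ
    by_contra h
    exact hk2 (Finset.mem_union_right _ (Finset.mem_filter.2 ⟨hk1, not_le.1 h, hkZ⟩))
  have hQT : ∑ k ∈ T₁, Q k + ∑ k ∈ T₂, Q k + q ≤ 1 := by
    rw [← Finset.sum_union hdisj]
    exact (add_le_add_left (Finset.sum_le_sum_of_subset_of_nonneg
      (Finset.union_subset hT₁S hT₂S) fun k hk _ => hQ0 k (hSP k hk)) q).trans hQsum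
  have hQT₁ : T₁.card * Z ≤ ∑ k ∈ T₁, Q k := by
    rw [← nsmul_eq_mul]
    exact Finset.card_nsmul_le_sum _ _ _ fun k hk => (Finset.mem_filter.1 hk).2
  have hQT₂ : T₂.card * q ≤ ∑ k ∈ T₂, Q k := by
    rw [← nsmul_eq_mul]
    exact Finset.card_nsmul_le_sum _ _ _ fun k hk => (Finset.mem_filter.1 hk).2.1.le
  have hCT₂ : ∑ k ∈ T₂, C k ≤ T₂.card * (η * max (2 * q - Z) 0) := by
    rw [← nsmul_eq_mul]
    refine Finset.sum_le_card_nsmul _ _ _ fun k hk => ?_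
    have hkZ := (Finset.mem_filter.1 hk).2.2
    have := hCC hqZ k (hSP k (hT₂S hk)) (by linarith)
    rw [max_eq_right (by linarith : Q k - Z ≤ 0), mul_zero, add_zero] at this
    exact this.trans (mul_le_mul_of_nonneg_left (le_max_left _ _) hη)
  have hout1 := hout (fun k hk => hCA k (Finset.mem_sdiff.1 hk).1)
  have houtC : (∀ k ∈ P, Q k < x) → ∑ k ∈ P \ S, C k ≤
      c * (η * (2 * q - Z) + (1 - η) * max (1 - Z) 0) := by
    intro hall
    refine hout fun k hk => ?_
    have hkP := (Finset.mem_sdiff.1 hk).1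
    refine (hCC hqZ k hkP (hall k hkP)).trans ?_
    have : max (Q k - Z) 0 ≤ max (1 - Z) 0 := max_le_max_right _ (by linarith [hQ1 k hkP])
    have := mul_le_mul_of_nonneg_left this (by linarith : 0 ≤ 1 - η)
    linarith
  have hX1 : ∀ {B : ℝ}, x ≤ B → X ≤ (1 - η) * B := fun h =>
    hXx.trans (mul_le_mul_of_nonneg_left h (by linarith))
  rcases T₁.eq_empty_or_nonempty with hT | ⟨l, hl⟩
  · rw [hT, Finset.sum_empty, zero_add] at hQT hin
    have hm : (T₂.card + 1 : ℝ) * q ≤ 1 := by linarith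
    have hm' : T₂.card = 0 ∨ (T₂.card + 1 : ℝ) * q < 1 := by
      rcases T₂.eq_empty_or_nonempty with h | h
      · exact Or.inl (by rw [h, Finset.card_empty])
      · right
        have : ∑ _k ∈ T₂, q < ∑ k ∈ T₂, Q k :=
          Finset.sum_lt_sum_of_nonempty h fun k hk => (Finset.mem_filter.1 hk).2.1
        rw [Finset.sum_const, nsmul_eq_mul] at this
        linarith
    -- A part with reach at least x escapes `hCC`, but its existence gives x ≤ 1 and hence X ≤ 1 -
    -- η, which serves instead.
    by_cases hall : ∀ k ∈ P, Q k < x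
    · exact false_of_all_small hη hη1 hq0 (hQ1 j hjP) hm hZ (by linarith)
        (by linarith [houtC hall])
    · push Not at hall
      obtain ⟨k, hk, hkx⟩ := hall
      have hkS : k ∉ S := by
        intro hkS
        rcases eq_or_ne k j with rfl | hkj
        · linarith
        · have : k ∈ T₁ := Finset.mem_filter.2 ⟨Finset.mem_erase.2 ⟨hkj, hkS⟩, hZx.trans hkx⟩
          rw [hT] at this
          exact absurd this (Finset.notMem_empty _)
      have hc1 : 1 ≤ c := Finset.card_pos.2 ⟨k, Finset.mem_sdiff.2 ⟨hk, hkS⟩⟩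
      have := hX1 (hkx.trans (hQ1 k hk))
      exact false_of_large_outside hη hη1 hq0 hc1 hm hm' hZ (by linarith) (by linarith)
  · have hlS := hT₁S hl
    have hlP := hSP l hlS
    have hlZ : Z ≤ Q l := (Finset.mem_filter.1 hl).2
    have hlq := hle l hlS
    have hcard : T₁ = {l} := by
      refine Finset.eq_singleton_iff_unique_mem.2 ⟨hl, ?_⟩
      have : (T₁.card : ℝ) < 2 := by
        have := Finset.sum_nonneg (s := T₂) fun k hk => hQ0 k (hSP k (hT₂S hk))
        nlinarith
      have : T₁.card < 2 := by exact_mod_cast this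
      exact fun k hk => Finset.card_le_one.1 (by omega) k hk l hl
    rw [hcard, Finset.sum_singleton] at hin hQT
    -- A costly element of T₂ would need Z < 2q; together with l and j it would have reach at least
    -- Z + 2q > 2Z > 1.
    have hT₂0 : ∑ k ∈ T₂, C k ≤ 0 := by
      rcases le_or_gt (2 * q) Z with h | h
      · rw [max_eq_right (by linarith)] at hCT₂
        simpa using hCT₂
      · rcases Nat.eq_zero_or_pos T₂.card with h0 | h0
        · rw [h0] at hCT₂
          simpa using hCT₂
        · have : (1 : ℝ) ≤ T₂.card := by exact_mod_cast h0
          nlinarith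
    rcases le_or_gt x (Q l) with hlx | hlx
    · have hXq := hX1 (B := 1 - q) (by linarith)
      have := hCA l hlP
      exact false_of_big_sibling hη hη1.le hq0 hc0 hZX hZ hXq (by linarith)
    · have hCl : C l ≤ η * (2 * q - Z) + (1 - η) * (1 - q - Z) := by
        refine (hCC hqZ l hlP hlx).trans ?_
        rw [max_eq_left (by linarith)]
        have := mul_le_mul_of_nonneg_left (by linarith : Q l - Z ≤ 1 - q - Z)
          (by linarith : 0 ≤ 1 - η)
        linarith
      by_cases hall : ∀ k ∈ P, Q k < x
      · have h3 := houtC hall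
        rw [max_eq_left (by linarith)] at h3
        have := hCA l hlP
        exact false_of_all_small_with_sibling hη hη1 hc0 hZ (by linarith) (by linarith)
          (by linarith)
      · push Not at hall
        obtain ⟨k, hk, hkx⟩ := hall
        have := hX1 (hkx.trans (hQ1 k hk))
        exact false_of_medium_sibling hη hc0 hq0 hZ (by linarith) (by linarith) (by linarith)

/-! ### Summing the bound over the reached parts -/

section Core

variable {ι α : Type*} [DecidableEq ι] {P S : Finset ι} {B : Finset α} {r : ℕ → ι → α → ℝ}
  {q : ℕ → ι → ℝ} {κ lam : ι → ι → ℝ} {Δ D K n : ℝ} {T : ℕ}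

/-- Dividing regrets by 2DT and total reach by T turns the transfer error into Q, the normal form of
`scaled_regret_le`. The choice η = n L / Θ trades the ℓ² norm of the reach at j for its ℓ¹ norm. -/
theorem regret_le_of_pos (hS : S ⊆ P) (hΔ : 0 ≤ Δ) (hD : 0 < D) (hK : 1 ≤ K) (hn : 0 ≤ n)
    (hT : 0 < T) (hq0 : ∀ t, ∀ k ∈ P, 0 ≤ q t k) (hq1 : ∀ t, ∀ k ∈ P, q t k ≤ 1)
    (hqS : ∀ t, ∑ k ∈ S, q t k ≤ 1)
    (hlam : ∀ k ∈ P, ∀ l ∈ P, 0 ≤ lam k l ∧ ∀ t, q t k = lam k l * q t l)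
    (hκ : ∀ k ∈ P, ∀ l ∈ P, 0 ≤ κ k l ∧ κ k l ≤ K)
    (hr : ∀ t, ∀ k ∈ P, ∀ a ∈ B, |r t k a| ≤ Δ * q t k)
    (hrκ : ∀ t, ∀ k ∈ P, ∀ l ∈ P, ∀ a ∈ B, |r t k a - κ k l * r t l a| ≤ 2 * D * q t l)
    (hreg : ∀ b : ℕ → ℝ, (∀ t, ∀ a ∈ B, |∑ k ∈ P, r t k a| ≤ b t) → ∀ a ∈ B,
      ∑ t ∈ Finset.range T, ∑ k ∈ P, r t k a ≤ n * √(∑ t ∈ Finset.range T, b t ^ 2))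
    {j : ι} (hj : j ∈ S) {a : α} (ha : a ∈ B) :
    ∑ t ∈ Finset.range T, r t j a ≤ K * (n * (Δ * √(∑ t ∈ Finset.range T, q t j ^ 2))) +
      D * (T + (P \ S).card * ∑ t ∈ Finset.range T, q t j) := by
  have hjP := hS hj
  have hT0 : (0 : ℝ) < T := by exact_mod_cast hT
  set Θ := ∑ t ∈ Finset.range T, q t j with hΘ
  set L := √(∑ t ∈ Finset.range T, q t j ^ 2) with hL
  have hΘ0 : 0 ≤ Θ := Finset.sum_nonneg fun t _ => hq0 t j hjP
  have hL0 : 0 ≤ L := Real.sqrt_nonneg _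
  have hsum_le : ∀ k ∈ P, ∑ t ∈ Finset.range T, r t k a ≤ Δ * ∑ t ∈ Finset.range T, q t k := by
    intro k hk
    rw [Finset.mul_sum]
    exact Finset.sum_le_sum fun t _ => (le_abs_self _).trans (hr t k hk a ha)
  -- The choice of η divides by Θ; if Θ = 0, the regret at j is itself at most 0.
  rcases hΘ0.eq_or_lt with h0 | hΘpos
  · have h1 := hsum_le j hjP
    rw [← hΘ, ← h0, mul_zero] at h1
    have : 0 ≤ K * (n * (Δ * L)) + D * (T + (P \ S).card * Θ) := by positivity
    linarith
  -- Two bounds on the regret at k by a multiple of the reach at j: through the ratio of reaches and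
  -- through the comparison of regrets. They become `hb1` and `hb2`. As all are multiples of the
  -- same sequence, the norm in the regret-matching bound is exactly the sum of β times L.
  set β : ι → ℝ := fun k => min (Δ * lam k j) (κ k j * Δ + 2 * D) with hβ
  have hβ0 : ∀ k ∈ P, 0 ≤ β k := fun k hk => le_min (mul_nonneg hΔ (hlam k hk j hjP).1)
    (by have := mul_nonneg (hκ k hk j hjP).1 hΔ; linarith)
  have hrβ : ∀ t, ∀ k ∈ P, ∀ a ∈ B, |r t k a| ≤ β k * q t j := by
    intro t k hk a ha
    rw [hβ, min_mul_of_nonneg _ _ (hq0 t j hjP)]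
    refine le_min ?_ ?_
    · rw [mul_assoc, ← (hlam k hk j hjP).2 t]
      exact hr t k hk a ha
    · have h1 := hrκ t k hk j hjP a ha
      have h2 := mul_le_mul_of_nonneg_left (hr t j hjP a ha) (hκ k hk j hjP).1
      have h3 : |r t k a| ≤ |r t k a - κ k j * r t j a| + |κ k j * r t j a| := by
        simpa using abs_add_le (r t k a - κ k j * r t j a) (κ k j * r t j a)
      rw [abs_mul, abs_of_nonneg (hκ k hk j hjP).1] at h3
      linarith
  have hsumβ : 0 ≤ ∑ k ∈ P, β k := Finset.sum_nonneg hβ0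
  have hRM := hreg (fun t => (∑ k ∈ P, β k) * q t j) (fun t a ha => by
    rw [Finset.sum_mul]
    exact (Finset.abs_sum_le_sum_abs _ _).trans (Finset.sum_le_sum fun k hk => hrβ t k hk a ha))
    a ha
  simp only [mul_pow, ← Finset.mul_sum] at hRM
  rw [Real.sqrt_mul (sq_nonneg _), Real.sqrt_sq hsumβ, ← hL, Finset.sum_comm] at hRM
  have hDT : 0 < 2 * D * T := by positivity
  have hsub : ∀ k ∈ P, ∀ l ∈ P,
      |∑ t ∈ Finset.range T, r t k a - κ k l * ∑ t ∈ Finset.range T, r t l a| ≤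
        2 * D * ∑ t ∈ Finset.range T, q t l := by
    intro k hk l hl
    rw [Finset.mul_sum, Finset.mul_sum, ← Finset.sum_sub_distrib]
    exact (Finset.abs_sum_le_sum_abs _ _).trans
      (Finset.sum_le_sum fun t _ => hrκ t k hk l hl a ha)
  have key := scaled_regret_le hS hj
    (Q := fun k => (∑ t ∈ Finset.range T, q t k) / T)
    (ρ := fun k => (∑ t ∈ Finset.range T, r t k a) / (2 * D * T))
    (b := fun k => β k * Θ / (2 * D * T)) (κ := fun k => κ j k) (κ' := fun k => κ k j)
    (Δ := Δ / (2 * D)) (η := n * L / Θ) (K := K) (by positivity) (by positivity) hK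
    (fun k hk => div_nonneg (Finset.sum_nonneg fun t _ => hq0 t k hk) hT0.le)
    (fun k hk => by
      rw [div_le_one hT0]
      simpa using Finset.sum_le_sum fun t (_ : t ∈ Finset.range T) => hq1 t k hk)
    (by
      rw [← Finset.sum_div, Finset.sum_comm, div_le_one hT0]
      simpa using Finset.sum_le_sum fun t (_ : t ∈ Finset.range T) => hqS t)
    (fun k hk => hκ j hjP k hk) (fun k hk => (hκ k hk j hjP).1)
    (fun k hk => by
      have h := (abs_le.1 (hsub j hjP k hk)).2
      have e : κ j k * ((∑ t ∈ Finset.range T, r t k a) / (2 * D * T)) +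
          (∑ t ∈ Finset.range T, q t k) / T =
          (κ j k * (∑ t ∈ Finset.range T, r t k a) + 2 * D * ∑ t ∈ Finset.range T, q t k) /
            (2 * D * T) := by field_simp
      rw [e]
      exact div_le_div_of_nonneg_right (by linarith) hDT.le)
    (fun k hk => by
      have h := (abs_le.1 (hsub k hk j hjP)).1
      have e : κ k j * ((∑ t ∈ Finset.range T, r t j a) / (2 * D * T)) - Θ / T =
          (κ k j * (∑ t ∈ Finset.range T, r t j a) - 2 * D * Θ) / (2 * D * T) := by field_simp
      rw [← hΘ, e]
      exact div_le_div_of_nonneg_right (by linarith) hDT.le)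
    (by
      have e : Δ / (2 * D) * (Θ / T) = Δ * Θ / (2 * D * T) := by field_simp
      rw [← hΘ, e]
      exact div_le_div_of_nonneg_right (hsum_le j hjP) hDT.le)
    (fun k hk => by
      have e : Δ / (2 * D) * ((∑ t ∈ Finset.range T, q t k) / T) =
          Δ * lam k j * Θ / (2 * D * T) := by
        rw [Finset.sum_congr rfl fun t _ => (hlam k hk j hjP).2 t, ← Finset.mul_sum, ← hΘ]
        field_simp
      rw [e]
      exact div_le_div_of_nonneg_right (mul_le_mul_of_nonneg_right (min_le_left _ _) hΘ0) hDT.le)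
    (fun k hk => by
      have e : (κ k j * (Δ / (2 * D)) + 1) * (Θ / T) =
          (κ k j * Δ + 2 * D) * Θ / (2 * D * T) := by field_simp
      rw [← hΘ, e]
      exact div_le_div_of_nonneg_right (mul_le_mul_of_nonneg_right (min_le_right _ _) hΘ0) hDT.le)
    (by
      rw [← Finset.sum_div, ← Finset.sum_div, ← Finset.sum_mul]
      have e : n * L / Θ * ((∑ k ∈ P, β k) * Θ / (2 * D * T)) =
          n * ((∑ k ∈ P, β k) * L) / (2 * D * T) := by field_simp
      rw [e]
      exact div_le_div_of_nonneg_right hRM hDT.le)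
  rw [div_le_iff₀ hDT, ← hΘ] at key
  refine key.trans (le_of_eq ?_)
  field_simp

/-- The scaling needs D > 0. Enlarging D only weakens the hypotheses, so D = 0 follows by letting
the enlargement ε / W tend to 0. -/
theorem regret_le (hS : S ⊆ P) (hΔ : 0 ≤ Δ) (hD : 0 ≤ D) (hK : 1 ≤ K) (hn : 0 ≤ n)
    (hT : 0 < T) (hq0 : ∀ t, ∀ k ∈ P, 0 ≤ q t k) (hq1 : ∀ t, ∀ k ∈ P, q t k ≤ 1)
    (hqS : ∀ t, ∑ k ∈ S, q t k ≤ 1)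
    (hlam : ∀ k ∈ P, ∀ l ∈ P, 0 ≤ lam k l ∧ ∀ t, q t k = lam k l * q t l)
    (hκ : ∀ k ∈ P, ∀ l ∈ P, 0 ≤ κ k l ∧ κ k l ≤ K)
    (hr : ∀ t, ∀ k ∈ P, ∀ a ∈ B, |r t k a| ≤ Δ * q t k)
    (hrκ : ∀ t, ∀ k ∈ P, ∀ l ∈ P, ∀ a ∈ B, |r t k a - κ k l * r t l a| ≤ 2 * D * q t l)
    (hreg : ∀ b : ℕ → ℝ, (∀ t, ∀ a ∈ B, |∑ k ∈ P, r t k a| ≤ b t) → ∀ a ∈ B,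
      ∑ t ∈ Finset.range T, ∑ k ∈ P, r t k a ≤ n * √(∑ t ∈ Finset.range T, b t ^ 2))
    {j : ι} (hj : j ∈ S) {a : α} (ha : a ∈ B) :
    ∑ t ∈ Finset.range T, r t j a ≤ K * (n * (Δ * √(∑ t ∈ Finset.range T, q t j ^ 2))) +
      D * (T + (P \ S).card * ∑ t ∈ Finset.range T, q t j) := by
  have hT0 : (0 : ℝ) < T := by exact_mod_cast hT
  have hW : 0 < T + (P \ S).card * ∑ t ∈ Finset.range T, q t j := by
    have : 0 ≤ ∑ t ∈ Finset.range T, q t j := Finset.sum_nonneg fun t _ => hq0 t j (hS hj)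
    positivity
  set W := T + (P \ S).card * ∑ t ∈ Finset.range T, q t j
  refine le_of_forall_pos_le_add fun ε hε => ?_
  have h1 := regret_le_of_pos (D := D + ε / W) hS hΔ (by positivity) hK hn hT hq0 hq1 hqS hlam hκ
    hr (fun t k hk l hl a ha => (hrκ t k hk l hl a ha).trans
      (mul_le_mul_of_nonneg_right (by have : 0 ≤ ε / W := by positivity
                                      linarith) (hq0 t l hl))) hreg hj ha
  have : (D + ε / W) * W = D * W + ε := by field_simp
  linarith

theorem sum_regret_le (hS : S ⊆ P) (hΔ : 0 ≤ Δ) (hD : 0 ≤ D) (hK : 1 ≤ K) (hn : 0 ≤ n)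
    (hT : 0 < T) (hq0 : ∀ t, ∀ k ∈ P, 0 ≤ q t k) (hq1 : ∀ t, ∀ k ∈ P, q t k ≤ 1)
    (hqS : ∀ t, ∑ k ∈ S, q t k ≤ 1)
    (hlam : ∀ k ∈ P, ∀ l ∈ P, 0 ≤ lam k l ∧ ∀ t, q t k = lam k l * q t l)
    (hκ : ∀ k ∈ P, ∀ l ∈ P, 0 ≤ κ k l ∧ κ k l ≤ K)
    (hr : ∀ t, ∀ k ∈ P, ∀ a ∈ B, |r t k a| ≤ Δ * q t k)
    (hrκ : ∀ t, ∀ k ∈ P, ∀ l ∈ P, ∀ a ∈ B, |r t k a - κ k l * r t l a| ≤ 2 * D * q t l)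
    (hreg : ∀ b : ℕ → ℝ, (∀ t, ∀ a ∈ B, |∑ k ∈ P, r t k a| ≤ b t) → ∀ a ∈ B,
      ∑ t ∈ Finset.range T, ∑ k ∈ P, r t k a ≤ n * √(∑ t ∈ Finset.range T, b t ^ 2))
    {act : ι → α} (hact : ∀ k ∈ S, act k ∈ B) :
    ∑ k ∈ S, ∑ t ∈ Finset.range T, r t k (act k) ≤
      K * (n * (Δ * √(T : ℝ))) + D * (T * P.card) := by
  have hT0 : (0 : ℝ) < T := by exact_mod_cast hT
  have hL : ∑ k ∈ S, √(∑ t ∈ Finset.range T, q t k ^ 2) ≤ √(T : ℝ) := by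
    rcases S.eq_empty_or_nonempty with rfl | ⟨j, hj⟩
    · simp
    have h0 : 0 ≤ ∑ k ∈ S, lam k j :=
      Finset.sum_nonneg fun k hk => (hlam k (hS hk) j (hS hj)).1
    -- The triangle inequality points the wrong way here; it is an equality because all these
    -- sequences are multiples of the one at j.
    have e1 : ∑ k ∈ S, √(∑ t ∈ Finset.range T, q t k ^ 2) =
        √(∑ t ∈ Finset.range T, (∑ k ∈ S, q t k) ^ 2) := by
      have : ∀ t, ∑ k ∈ S, q t k = (∑ k ∈ S, lam k j) * q t j := fun t => by
        rw [Finset.sum_mul]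
        exact Finset.sum_congr rfl fun k hk => (hlam k (hS hk) j (hS hj)).2 t
      simp only [this, mul_pow]
      rw [← Finset.mul_sum, Real.sqrt_mul (sq_nonneg _), Real.sqrt_sq h0, Finset.sum_mul]
      refine Finset.sum_congr rfl fun k hk => ?_
      obtain ⟨h1, h2⟩ := hlam k (hS hk) j (hS hj)
      simp only [h2, mul_pow]
      rw [← Finset.mul_sum, Real.sqrt_mul (sq_nonneg _), Real.sqrt_sq h1]
    rw [e1]
    refine Real.sqrt_le_sqrt ?_
    have : ∀ t ∈ Finset.range T, (∑ k ∈ S, q t k) ^ 2 ≤ 1 := fun t _ =>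
      pow_le_one₀ (Finset.sum_nonneg fun k hk => hq0 t k (hS hk)) (hqS t)
    simpa using Finset.sum_le_sum this
  have hQ : ∑ k ∈ S, ∑ t ∈ Finset.range T, q t k ≤ T := by
    rw [Finset.sum_comm]
    simpa using Finset.sum_le_sum fun t (_ : t ∈ Finset.range T) => hqS t
  calc _ ≤ ∑ k ∈ S, (K * (n * (Δ * √(∑ t ∈ Finset.range T, q t k ^ 2))) +
        D * (T + (P \ S).card * ∑ t ∈ Finset.range T, q t k)) :=
        Finset.sum_le_sum fun k hk =>
          regret_le hS hΔ hD hK hn hT hq0 hq1 hqS hlam hκ hr hrκ hreg hk (hact k hk)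
    _ = K * (n * (Δ * ∑ k ∈ S, √(∑ t ∈ Finset.range T, q t k ^ 2))) +
        D * (S.card * T + (P \ S).card * ∑ k ∈ S, ∑ t ∈ Finset.range T, q t k) := by
      simp only [Finset.sum_add_distrib, ← Finset.mul_sum, Finset.sum_const, nsmul_eq_mul]
    _ ≤ K * (n * (Δ * √(T : ℝ))) + D * (S.card * T + (P \ S).card * T) := by
      gcongr
    _ = _ := by
      have : (P.card : ℝ) = (P \ S).card + S.card := by
        exact_mod_cast (Finset.card_sdiff_add_card_eq_card hS).symm
      rw [this]
      ring

end Core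

/-! ### Pure strategies of the refinement -/

theorem mem_decisions_iff {h z : List A} (hz : h <+: z) {g : List A} {a : A} :
    (g, a) ∈ decisions h z ↔ h <+: g ∧ g ++ [a] <+: z := by
  refine ⟨fun hs => mem_decisions hz hs, ?_⟩
  refine prefix_induction (P := fun z => h <+: g ∧ g ++ [a] <+: z → (g, a) ∈ decisions h z)
    ?_ ?_ hz
  · rintro ⟨h1, h2⟩
    exact absurd (h2.trans h1) (not_concat_prefix_self _ _)
  · rintro z b hz ih ⟨h1, h2⟩
    rw [decisions_concat hz, List.mem_append]
    rcases List.prefix_concat_iff.1 h2 with h3 | h3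
    · obtain ⟨rfl, h4⟩ := List.append_inj' h3 rfl
      right
      simpa using h4
    · exact Or.inl (ih ⟨h1, h3⟩)

theorem Info.mem_ownSeq (𝓘 : G.Info) {i : N} {h : List A} {K : Finset (List A)} {a : A} :
    (K, a) ∈ 𝓘.ownSeq i [] h ↔
      ∃ g, G.turn g = some i ∧ g ++ [a] <+: h ∧ (𝓘.part i).part g = K := by
  unfold Info.ownSeq Info.seqOf
  simp only [List.mem_filterMap, Prod.exists, mem_decisions_iff List.nil_prefix, List.nil_prefix,
    true_and]
  constructor
  · rintro ⟨g, b, hg, hs⟩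
    cases ht : G.turn g with
    | none => simp [ht] at hs
    | some j =>
      by_cases hj : j = i
      · subst hj
        simp only [ht, if_true, Option.some.injEq, Prod.mk.injEq] at hs
        obtain ⟨rfl, rfl⟩ := hs
        exact ⟨g, ht, hg, rfl⟩
      · simp [ht, hj] at hs
  · rintro ⟨g, ht, hg, rfl⟩
    exact ⟨g, a, hg, by simp [ht]⟩

/-- Equal own sequences at h and h' make the set of g occur with action a before h' too; since no
set is met twice, it occurs there at g itself. -/
theorem Info.PerfectRecall.action_unique {𝓙 : G.Info} (h𝓙 : 𝓙.PerfectRecall) {i : N}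
    {J : Finset (List A)} (hJ : J ∈ 𝓙.sets i) {g h h' : List A} (hg : G.turn g = some i) {a b : A}
    (hh : h ∈ J) (hh' : h' ∈ J) (ha : g ++ [a] <+: h) (hb : g ++ [b] <+: h') : a = b := by
  have hnode : ∀ {g' a' l}, G.turn g' = some i → l ∈ J → g' ++ [a'] <+: l → g' ∈ G.nodes i :=
    fun {g' a' l} ht hl hp => by
      have := G.prefix_mem hp (𝓙.mem_H hJ hl)
      exact mem_nodes.2 ⟨G.prefix_closed _ _ this, ⟨a', mem_acts.2 this⟩, ht⟩
  have h1 : ((𝓙.part i).part g, a) ∈ 𝓙.ownSeq i [] h := 𝓙.mem_ownSeq.2 ⟨g, hg, ha, rfl⟩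
  rw [h𝓙 i J hJ h hh h' hh'] at h1
  obtain ⟨g', ht, hp, he⟩ := 𝓙.mem_ownSeq.1 h1
  have hgn := hnode hg hh ha
  have hgn' := hnode ht hh' hp
  have : g' = g := (𝓙.prefixFree (𝓙.part_mem_sets hgn)).eq_of_prefix (he ▸ 𝓙.mem_part hgn')
    (𝓙.mem_part hgn) ((List.prefix_append _ _).trans hp) ((List.prefix_append _ _).trans hb)
  subst this
  exact eq_of_concat_prefix hp hb

/-- The contribution of player `i` to reaching `h` when playing `s`. -/
def ownReach (G : GameTree N A) (i : N) (s : List A → A → ℝ) (h : List A) : ℝ :=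
  pathProd (fun g a => if G.turn g = some i then s g a else 1) [] h

theorem reach_update (σ : N → List A → A → ℝ) (i : N) (s : List A → A → ℝ) (h : List A) :
    G.reach (Function.update σ i s) [] h = G.ownReach i s h * G.reachOpp σ i [] h := by
  rw [reach_eq_own_mul_opp _ i, reachOpp_congr (σ' := σ) (fun j hj => by simp [hj]),
    playProb_eq_pathProd, ownReach]
  congr 2
  ext g a
  split_ifs with hg
  · rw [prob_of_turn hg, Function.update_self]
  · rfl

/-- Let player i steer towards J. By perfect recall the actions leading to its various elements
never conflict, so i contributes 1 to reaching each of them, and the opponents' reach becomes the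
probability of passing through J. -/
theorem Info.PerfectRecall.oppReach_le_one {𝓙 : G.Info} (h𝓙 : 𝓙.PerfectRecall)
    {σ : N → List A → A → ℝ} (hσ : G.Stochastic σ) {i : N} {J : Finset (List A)}
    (hJ : J ∈ 𝓙.sets i) : G.oppReach i σ J ≤ 1 := by
  classical
  set s : List A → A → ℝ := fun g b => if ∃ h ∈ J, g ++ [b] <+: h then 1 else
    if ∃ a, ∃ h ∈ J, g ++ [a] <+: h then 0 else σ i g b with hs
  have hsb : G.IsBehavioral i s := by
    intro g hg
    obtain ⟨hgH, hgn, hgi⟩ := mem_nodes.1 hg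
    by_cases hex : ∃ a, ∃ h ∈ J, g ++ [a] <+: h
    · obtain ⟨a, h, hh, ha⟩ := hex
      have hsg : ∀ b, s g b = if b = a then 1 else 0 := by
        intro b
        have : (∃ h ∈ J, g ++ [b] <+: h) ↔ b = a := by
          constructor
          · rintro ⟨h', hh', hb⟩
            exact h𝓙.action_unique hJ hgi hh' hh hb ha
          · rintro rfl
            exact ⟨h, hh, ha⟩
        simp only [hs, this]
        rw [if_pos (⟨a, h, hh, ha⟩ : ∃ a, ∃ h ∈ J, g ++ [a] <+: h)]
      have haa : a ∈ G.acts g := mem_acts.2 (G.prefix_mem ha (𝓙.mem_H hJ hh))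
      simp only [hsg]
      exact ⟨fun b _ => by split_ifs <;> norm_num, by simp [haa]⟩
    · have hsg : ∀ b, s g b = σ i g b := by
        intro b
        simp only [hs]
        rw [if_neg (fun h => hex ⟨b, h⟩), if_neg hex]
      have := hσ g hgH hgn
      simpa only [hsg, prob_of_turn hgi] using this
  have hone : ∀ h ∈ J, G.ownReach i s h = 1 := by
    intro h hh
    have : G.ownReach i s h = pathProd (fun _ _ => (1 : ℝ)) [] h := by
      refine pathProd_congr List.nil_prefix fun g a _ hga => ?_
      split_ifs
      · simp only [hs]
        rw [if_pos ⟨h, hh, hga⟩]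
      · rfl
    rw [this]
    simp [pathProd]
  refine le_trans (le_of_eq ?_)
    ((hσ.update hsb).sum_reach_le_one (𝓙.prefixFree hJ) fun _ => 𝓙.mem_H hJ)
  refine Finset.sum_congr rfl fun h hh => ?_
  rw [reach_update, hone h hh, one_mul]

theorem Info.IsAbstractionOf.isStrategy {𝓘 𝓙 : G.Info} (hab : 𝓘.IsAbstractionOf 𝓙) {i : N}
    {s : List A → A → ℝ} (hs : 𝓘.IsStrategy i s) : 𝓙.IsStrategy i s := by
  refine ⟨hs.1, fun J hJ h hh h' hh' a ha => ?_⟩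
  have hn := 𝓙.subset_nodes hJ hh
  have hn' := 𝓙.subset_nodes hJ hh'
  have := hab i h hn h' hn' (by rw [𝓙.part_eq hJ hh, 𝓙.part_eq hJ hh'])
  exact hs.2 _ (𝓘.part_mem_sets hn) h (𝓘.mem_part hn) h' (this ▸ 𝓘.mem_part hn') a ha

theorem switchTo_update (σ : N → List A → A → ℝ) (i : N) (s : List A → A → ℝ)
    (J : Finset (List A)) (a : A) :
    switchTo (Function.update σ i s) i J a =
      Function.update σ i (fun h b => if h ∈ J then (if b = a then 1 else 0) else s h b) := by
  simp [switchTo]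

/-- A path meets J at most once, so its probability is affine in the behaviour at J. -/
theorem Info.reach_eq_sum_switchTo (𝓙 : G.Info) {i : N} (τ : N → List A → A → ℝ)
    (hτ : 𝓙.IsStrategy i (τ i)) {J : Finset (List A)} (hJ : J ∈ 𝓙.sets i) {h₀ : List A}
    (h₀J : h₀ ∈ J) {z : List A} (hz : z ∈ G.terminals) :
    G.reach τ [] z = ∑ a ∈ G.actsAt J, τ i h₀ a * G.reach (switchTo τ i J a) [] z := by
  obtain ⟨hzH, hzt⟩ := Finset.mem_filter.1 hz
  have hfree := 𝓙.prefixFree hJ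
  by_cases hex : ∃ h ∈ J, h <+: z
  · obtain ⟨h, hh, hp⟩ := hex
    obtain ⟨b, hb⟩ : ∃ b, h ++ [b] <+: z := by
      rcases prefix_iff_eq_or_concat.1 hp with rfl | hb
      · exact absurd hzt (mem_nodes.1 (𝓙.subset_nodes hJ hh)).2.1.ne_empty
      · exact hb
    have hbJ : b ∈ G.actsAt J := by
      rw [𝓙.actsAt_eq hJ hh]
      exact mem_acts.2 (G.prefix_mem hb hzH)
    have hbefore : ∀ a, G.reach (switchTo τ i J a) [] h = G.reach τ [] h := by
      intro a
      simp only [reach_eq_pathProd]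
      refine pathProd_congr List.nil_prefix fun g c _ hg => prob_switchTo_of_notMem _ _ _ ?_ _
      intro hgJ
      have := hfree g hgJ h hh ((List.prefix_append _ _).trans hg)
      subst this
      exact not_concat_prefix_self _ _ hg
    have hsplit : ∀ τ' : N → List A → A → ℝ, G.reach τ' [] z =
        G.reach τ' [] h * (G.prob τ' h b * G.reach τ' (h ++ [b]) z) := by
      intro τ'
      rw [reach_trans τ' List.nil_prefix hp, reach_step τ' hb]
    have hsw : ∀ a, τ i h₀ a * G.reach (switchTo τ i J a) [] z =
        if b = a then G.reach τ [] z else 0 := by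
      intro a
      rw [hsplit (switchTo τ i J a), hbefore, 𝓙.prob_switchTo_of_mem τ hJ a hh,
        hfree.reach_switchTo τ i a hh (List.prefix_append _ _) (ne_concat _ _) hb]
      split_ifs with hba
      · subst hba
        rw [hsplit τ, prob_of_turn (𝓙.turn_eq hJ hh),
          hτ.2 J hJ h hh h₀ h₀J b (by rwa [← 𝓙.actsAt_eq hJ hh])]
        ring
      · ring
    simp only [hsw]
    simp [hbJ]
  · have hsw : ∀ a, G.reach (switchTo τ i J a) [] z = G.reach τ [] z := by
      intro a
      simp only [reach_eq_pathProd]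
      refine pathProd_congr List.nil_prefix fun g c _ hg => prob_switchTo_of_notMem _ _ _ ?_ _
      exact fun hgJ => hex ⟨g, hgJ, (List.prefix_append _ _).trans hg⟩
    simp only [hsw, ← Finset.sum_mul]
    rw [𝓙.actsAt_eq hJ h₀J, (hτ.1 h₀ (𝓙.subset_nodes hJ h₀J)).2, one_mul]

theorem Info.value_eq_sum_switchTo (𝓙 : G.Info) {i : N} (τ : N → List A → A → ℝ)
    (hτ : 𝓙.IsStrategy i (τ i)) {J : Finset (List A)} (hJ : J ∈ 𝓙.sets i) {h₀ : List A}
    (h₀J : h₀ ∈ J) :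
    G.value i τ = ∑ a ∈ G.actsAt J, τ i h₀ a * G.value i (switchTo τ i J a) := by
  simp only [value, Finset.mul_sum]
  rw [Finset.sum_comm]
  refine Finset.sum_congr rfl fun z hz => ?_
  rw [𝓙.reach_eq_sum_switchTo τ hτ hJ h₀J hz, Finset.mul_sum]
  exact Finset.sum_congr rfl fun a _ => by ring

/-- The strategy `s` always takes one and the same action at `J`. -/
def PureAt (G : GameTree N A) (s : List A → A → ℝ) (J : Finset (List A)) : Prop :=
  ∃ a ∈ G.actsAt J, ∀ h ∈ J, ∀ b, s h b = if b = a then 1 else 0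

/-- The gain of player `i` over `T` rounds from having played `s`. -/
def gain (G : GameTree N A) (i : N) (σ : ℕ → N → List A → A → ℝ) (T : ℕ)
    (s : List A → A → ℝ) : ℝ :=
  ∑ t ∈ Finset.range T, (G.value i (Function.update (σ t) i s) - G.value i (σ t))

theorem Info.exists_pureAt_set (𝓙 : G.Info) {i : N} (σ : ℕ → N → List A → A → ℝ) (T : ℕ)
    {s : List A → A → ℝ} (hs : 𝓙.IsStrategy i s) {J : Finset (List A)} (hJ : J ∈ 𝓙.sets i) :
    ∃ a ∈ G.actsAt J, G.gain i σ T s ≤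
      G.gain i σ T (fun h b => if h ∈ J then (if b = a then 1 else 0) else s h b) := by
  obtain ⟨h₀, h₀J⟩ := 𝓙.nonempty_of_mem hJ
  have hA := 𝓙.actsAt_eq hJ h₀J
  have hn := 𝓙.subset_nodes hJ h₀J
  obtain ⟨hs0, hs1⟩ := hs.1 h₀ hn
  rw [← hA] at hs0 hs1
  set F : A → ℝ := fun a =>
    G.gain i σ T (fun h b => if h ∈ J then (if b = a then 1 else 0) else s h b) with hF
  have hgain : G.gain i σ T s = ∑ a ∈ G.actsAt J, s h₀ a * F a := by
    simp only [hF, gain, Finset.mul_sum]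
    rw [Finset.sum_comm]
    refine Finset.sum_congr rfl fun t _ => ?_
    rw [𝓙.value_eq_sum_switchTo (Function.update (σ t) i s) (by simpa using hs) hJ h₀J]
    simp only [Function.update_self, switchTo_update, mul_sub, Finset.sum_sub_distrib,
      ← Finset.sum_mul, hs1, one_mul]
  obtain ⟨a, ha, hmax⟩ := (G.actsAt J).exists_max_image F (by rw [hA]; exact (mem_nodes.1 hn).2.1)
  refine ⟨a, ha, ?_⟩
  calc G.gain i σ T s = ∑ b ∈ G.actsAt J, s h₀ b * F b := hgain
    _ ≤ ∑ b ∈ G.actsAt J, s h₀ b * F a :=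
      Finset.sum_le_sum fun b hb => mul_le_mul_of_nonneg_left (hmax b hb) (hs0 b hb)
    _ = F a := by rw [← Finset.sum_mul, hs1, one_mul]

theorem Info.exists_pure (𝓙 : G.Info) {i : N} (σ : ℕ → N → List A → A → ℝ) (T : ℕ)
    {s : List A → A → ℝ} (hs : 𝓙.IsStrategy i s) :
    ∃ s', 𝓙.IsStrategy i s' ∧ (∀ J ∈ 𝓙.sets i, G.PureAt s' J) ∧
      G.gain i σ T s ≤ G.gain i σ T s' := by
  have key : ∀ F ⊆ 𝓙.sets i, ∃ s', 𝓙.IsStrategy i s' ∧ (∀ J ∈ F, G.PureAt s' J) ∧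
      G.gain i σ T s ≤ G.gain i σ T s' := by
    intro F
    induction F using Finset.induction_on with
    | empty => exact fun _ => ⟨s, hs, by simp, le_rfl⟩
    | insert J F hJF ih =>
      intro hF
      obtain ⟨s', hs', hpure, hle⟩ := ih ((Finset.subset_insert _ _).trans hF)
      have hJ := hF (Finset.mem_insert_self J F)
      obtain ⟨a, ha, hle'⟩ := 𝓙.exists_pureAt_set σ T hs' hJ
      refine ⟨_, 𝓙.isStrategy_switch hs' hJ ha, fun K hK => ?_, hle.trans hle'⟩
      rcases Finset.mem_insert.1 hK with rfl | hK'
      · exact ⟨a, ha, fun h hh b => if_pos hh⟩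
      · obtain ⟨b, hb, hsb⟩ := hpure K hK'
        -- Distinct sets are disjoint, so the new switch leaves the sets already treated pure.
        refine ⟨b, hb, fun h hh c => ?_⟩
        have hhJ : h ∉ J := by
          intro hhJ
          have : J = K := by rw [← 𝓙.part_eq hJ hhJ, 𝓙.part_eq (hF hK) hh]
          exact hJF (this ▸ hK')
        exact (if_neg hhJ).trans (hsb h hh c)
  exact key _ subset_rfl

theorem Info.sum_nodes (𝓙 : G.Info) (i : N) (F : List A → ℝ) :
    ∑ h ∈ G.nodes i, F h = ∑ J ∈ 𝓙.sets i, ∑ h ∈ J, F h := by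
  rw [← (𝓙.part i).biUnion_parts, Finset.sum_biUnion (𝓙.part i).disjoint]
  rfl

theorem value_update_sub (σ : N → List A → A → ℝ) (i : N) (s : List A → A → ℝ) :
    G.value i (Function.update σ i s) - G.value i σ =
      ∑ h ∈ G.nodes i, G.ownReach i s h * (G.reachOpp σ i [] h *
        ((∑ a ∈ G.acts h, s h a * G.payoff (G.u i) σ (h ++ [a])) - G.payoff (G.u i) σ h)) := by
  rw [value_eq_payoff, value_eq_payoff, payoff_sub_payoff (G.u i) (i := i)
    (fun j hj => by simp [hj]) [] G.root_mem, ← Finset.sum_filter]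
  refine Finset.sum_congr ?_ fun h hh => ?_
  · ext h
    simp only [below, List.nil_prefix, Finset.filter_true, Finset.mem_filter, mem_nodes]
    tauto
  · rw [reach_update, Function.update_self, mul_assoc]

/-! ### Gain of a pure comparator as a sum of counterfactual regrets -/

section Pure

variable {𝓙 : G.Info} {i : N} {s : List A → A → ℝ}

theorem ownReach_eq_zero_or_one (hpure : ∀ J ∈ 𝓙.sets i, G.PureAt s J) {h : List A}
    (hh : h ∈ G.H) : G.ownReach i s h = 0 ∨ G.ownReach i s h = 1 := by
  unfold ownReach
  revert hh
  refine prefix_induction (h := [])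
    (P := fun h => h ∈ G.H → pathProd _ [] h = 0 ∨ pathProd _ [] h = 1) ?_ ?_ List.nil_prefix
  · intro _
    right
    exact pathProd_self _ _
  · intro g a hg ih hga
    have hgH := G.prefix_closed _ _ hga
    rw [pathProd_concat _ hg]
    rcases ih hgH with h0 | h1
    · left; rw [h0, zero_mul]
    · rw [h1, one_mul]
      split_ifs with ht
      · have hn : g ∈ G.nodes i := mem_nodes.2 ⟨hgH, ⟨a, mem_acts.2 hga⟩, ht⟩
        obtain ⟨b, -, hb⟩ := hpure _ (𝓙.part_mem_sets hn)
        rw [hb g (𝓙.mem_part hn)]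
        split_ifs
        · exact Or.inr rfl
        · exact Or.inl rfl
      · exact Or.inr rfl

/-- The own contribution is a function of the own sequence, which perfect recall makes constant on
J. The profile σ only completes s to a profile. -/
theorem Info.PerfectRecall.ownReach_eq (h𝓙 : 𝓙.PerfectRecall) (hs : 𝓙.IsStrategy i s)
    {σ : N → List A → A → ℝ} (hσ : 𝓙.IsProfile σ) {J : Finset (List A)}
    (hJ : J ∈ 𝓙.sets i) {h h' : List A} (hh : h ∈ J) (hh' : h' ∈ J) :
    G.ownReach i s h = G.ownReach i s h' := by
  have hτ : 𝓙.IsProfile (Function.update σ i s) := by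
    intro j
    by_cases hj : j = i
    · subst hj
      simpa using hs
    · simpa [hj] using hσ j
  have key : ∀ g ∈ J, G.ownReach i s g = ((𝓙.ownSeq i [] g).map
      (fun p => G.setProb (Function.update σ i s) p.1 p.2)).prod := by
    intro g hg
    rw [Info.ownSeq, hτ.prod_seqOf _ List.nil_prefix (𝓙.mem_H hJ hg), ownReach]
    congr 1
    ext l a
    by_cases ht : G.turn l = some i
    · simp [ht, prob_of_turn ht]
    · simp [ht]
  rw [key h hh, key h' hh', h𝓙 i J hJ h hh h' hh']

/-- The information sets that `s` plays to reach. -/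
def support (𝓙 : G.Info) (i : N) (s : List A → A → ℝ) : Finset (Finset (List A)) :=
  (𝓙.sets i).filter (fun J => ∀ h ∈ J, G.ownReach i s h = 1)

/-- The comparator contributes 1 on these sets, so the opponents' reach is the reach under an actual
profile, and the union of the sets is prefix-free inside I. -/
theorem sum_support_oppReach_le_one (hs : 𝓙.IsStrategy i s)
    {σ : N → List A → A → ℝ} (hσ : G.Stochastic σ) {I : Finset (List A)} (hI : PrefixFree I)
    {S : Finset (Finset (List A))} (hS : S ⊆ support 𝓙 i s) (hSI : ∀ J ∈ S, J ⊆ I) :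
    ∑ J ∈ S, G.oppReach i σ J ≤ 1 := by
  have hmem : ∀ J ∈ S, J ∈ 𝓙.sets i ∧ ∀ h ∈ J, G.ownReach i s h = 1 := fun J hJ =>
    Finset.mem_filter.1 (hS hJ)
  have hsub : S.biUnion id ⊆ I := Finset.biUnion_subset.2 hSI
  have h1 := (hσ.update hs.1).sum_reach_le_one (hI.mono hsub) (fun h hh => by
    obtain ⟨J, hJ, hhJ⟩ := Finset.mem_biUnion.1 hh
    exact 𝓙.mem_H (hmem J hJ).1 hhJ)
  refine le_trans (le_of_eq ?_) h1
  rw [Finset.sum_biUnion]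
  · refine Finset.sum_congr rfl fun J hJ => Finset.sum_congr rfl fun h hh => ?_
    rw [reach_update, (hmem J hJ).2 h hh, one_mul]
  · exact fun J hJ J' hJ' hne => (𝓙.part i).disjoint (hmem J hJ).1 (hmem J' hJ').1 hne

theorem Info.PerfectRecall.value_update_sub_eq (h𝓙 : 𝓙.PerfectRecall) (hs : 𝓙.IsStrategy i s)
    {act : Finset (List A) → A}
    (hact : ∀ J ∈ 𝓙.sets i, act J ∈ G.actsAt J ∧
      ∀ h ∈ J, ∀ b, s h b = if b = act J then 1 else 0)
    {σ : N → List A → A → ℝ} (hσ : 𝓙.IsProfile σ) :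
    G.value i (Function.update σ i s) - G.value i σ =
      ∑ J ∈ support 𝓙 i s, G.regretAt i σ J (act J) := by
  rw [value_update_sub, 𝓙.sum_nodes, support, Finset.sum_filter]
  refine Finset.sum_congr rfl fun J hJ => ?_
  obtain ⟨haJ, hsJ⟩ := hact J hJ
  have hpure : ∀ J ∈ 𝓙.sets i, G.PureAt s J := fun J hJ => ⟨act J, hact J hJ⟩
  have hterm : ∀ h ∈ J, ∑ a ∈ G.acts h, s h a * G.payoff (G.u i) σ (h ++ [a]) =
      G.payoff (G.u i) σ (h ++ [act J]) := by
    intro h hh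
    rw [𝓙.actsAt_eq hJ hh] at haJ
    simp [hsJ h hh, haJ]
  split_ifs with hone
  · refine Finset.sum_congr rfl fun h hh => ?_
    rw [hone h hh, one_mul, hterm h hh]
  · push Not at hone
    obtain ⟨h, hh, hne⟩ := hone
    have h0 := (ownReach_eq_zero_or_one hpure (𝓙.mem_H hJ hh)).resolve_right hne
    refine Finset.sum_eq_zero fun h' hh' => ?_
    rw [h𝓙.ownReach_eq hs hσ hJ hh' hh, h0, zero_mul]

end Pure

/-! ### The regret bound -/

theorem Info.IsAbstractionOf.exists_superset {𝓘 𝓙 : G.Info} (hab : 𝓘.IsAbstractionOf 𝓙) {i : N}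
    {I : Finset (List A)} (hI : I ∈ 𝓘.sets i) {h : List A} (hh : h ∈ I) :
    (𝓙.part i).part h ∈ 𝓙.refined i I := by
  have hn := 𝓘.subset_nodes hI hh
  have hJ := 𝓙.part_mem_sets hn
  refine Info.mem_refined.2 ⟨hJ, fun g hg => ?_⟩
  have hgn := 𝓙.subset_nodes hJ hg
  have := hab i g hgn h hn (𝓙.part_eq hJ hg)
  rw [𝓘.part_eq hI hh] at this
  exact this ▸ 𝓘.mem_part hgn

theorem Info.refined_disjoint {𝓙 : G.Info} {i : N} {I : Finset (List A)} :
    ((𝓙.refined i I : Finset _) : Set (Finset (List A))).PairwiseDisjoint id :=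
  fun _ hJ _ hJ' hne =>
    (𝓙.part i).disjoint (Info.mem_refined.1 hJ).1 (Info.mem_refined.1 hJ').1 hne

theorem Info.IsAbstractionOf.biUnion_refined {𝓘 𝓙 : G.Info} (hab : 𝓘.IsAbstractionOf 𝓙) {i : N}
    {I : Finset (List A)} (hI : I ∈ 𝓘.sets i) : (𝓙.refined i I).biUnion id = I := by
  refine subset_antisymm (Finset.biUnion_subset.2 fun J hJ => (Info.mem_refined.1 hJ).2) ?_
  intro h hh
  exact Finset.mem_biUnion.2
    ⟨_, hab.exists_superset hI hh, 𝓙.mem_part (𝓘.subset_nodes hI hh)⟩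

theorem Info.IsAbstractionOf.sum_regretAt {𝓘 𝓙 : G.Info} (hab : 𝓘.IsAbstractionOf 𝓙) {i : N}
    {I : Finset (List A)} (hI : I ∈ 𝓘.sets i) (σ : N → List A → A → ℝ) (a : A) :
    ∑ J ∈ 𝓙.refined i I, G.regretAt i σ J a = G.regretAt i σ I a := by
  conv_rhs => rw [← hab.biUnion_refined hI, regretAt, Finset.sum_biUnion Info.refined_disjoint]
  rfl

theorem Info.IsAbstractionOf.sum_sets {𝓘 𝓙 : G.Info} (hab : 𝓘.IsAbstractionOf 𝓙) {i : N}
    {S : Finset (Finset (List A))} (hS : S ⊆ 𝓙.sets i) (F : Finset (List A) → ℝ) :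
    ∑ J ∈ S, F J = ∑ I ∈ 𝓘.sets i, ∑ J ∈ S ∩ 𝓙.refined i I, F J := by
  rw [← Finset.sum_biUnion]
  · refine Finset.sum_congr ?_ fun _ _ => rfl
    ext J
    simp only [Finset.mem_biUnion, Finset.mem_inter]
    constructor
    · intro hJ
      obtain ⟨h, hh⟩ := 𝓙.nonempty_of_mem (hS hJ)
      have hn := 𝓙.subset_nodes (hS hJ) hh
      have hI := 𝓘.part_mem_sets hn
      refine ⟨_, hI, hJ, ?_⟩
      have := hab.exists_superset hI (𝓘.mem_part hn)
      rwa [𝓙.part_eq (hS hJ) hh] at this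
    · rintro ⟨_, _, hJ, _⟩
      exact hJ
  · intro I hI I' hI' hne
    rw [Function.onFun, Finset.disjoint_left]
    intro J hJ hJ'
    obtain ⟨hJs, hJI⟩ := Info.mem_refined.1 (Finset.mem_inter.1 hJ).2
    obtain ⟨-, hJI'⟩ := Info.mem_refined.1 (Finset.mem_inter.1 hJ').2
    obtain ⟨h, hh⟩ := 𝓙.nonempty_of_mem hJs
    exact hne ((𝓘.part_eq hI (hJI hh)).symm.trans (𝓘.part_eq hI' (hJI' hh)))

theorem Info.le_maxPairs (𝓙 : G.Info) {i : N} {I J J' : Finset (List A)}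
    (f : Finset (List A) → Finset (List A) → ℝ) (hJ : J ∈ 𝓙.refined i I)
    (hJ' : J' ∈ 𝓙.refined i I) : f J J' ≤ 𝓙.maxPairs i I f :=
  le_csSup (Set.Finite.bddAbove ((Finset.finite_toSet _).image _))
    ⟨(J, J'), by simp [hJ, hJ'], rfl⟩

/-- The current strategy has no regret against itself; this is the orthogonality that regret
matching needs. -/
theorem Info.IsProfile.sum_mul_regretAt {𝓘 : G.Info} {σ : N → List A → A → ℝ}
    (hσ : 𝓘.IsProfile σ) {i : N} {I : Finset (List A)} (hI : I ∈ 𝓘.sets i) {h₀ : List A}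
    (h₀I : h₀ ∈ I) : ∑ a ∈ G.actsAt I, σ i h₀ a * G.regretAt i σ I a = 0 := by
  simp only [regretAt, Finset.mul_sum]
  rw [Finset.sum_comm]
  refine Finset.sum_eq_zero fun h hh => ?_
  have hn := 𝓘.subset_nodes hI hh
  obtain ⟨hhH, hne, ht⟩ := mem_nodes.1 hn
  rw [𝓘.actsAt_eq hI hh]
  have h1 := payoff_step (G.u i) σ hhH hne
  have h2 := ((hσ i).1 h hn).2
  have : ∀ a ∈ G.acts h, σ i h₀ a * (G.reachOpp σ i [] h *
      (G.payoff (G.u i) σ (h ++ [a]) - G.payoff (G.u i) σ h)) =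
      G.reachOpp σ i [] h * (G.prob σ h a * G.payoff (G.u i) σ (h ++ [a]) -
        σ i h a * G.payoff (G.u i) σ h) := by
    intro a ha
    rw [prob_of_turn ht, (hσ i).2 I hI h hh h₀ h₀I a ha]
    ring
  rw [Finset.sum_congr rfl this, ← Finset.mul_sum, Finset.sum_sub_distrib, ← h1, ← Finset.sum_mul,
    h2, one_mul, sub_self, mul_zero]

theorem Info.IsCFR.sum_regretAt_le {𝓘 : G.Info} {i : N} {σ : ℕ → N → List A → A → ℝ}
    (hcfr : 𝓘.IsCFR i σ) (hσ : ∀ t, 𝓘.IsProfile (σ t)) {I : Finset (List A)}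
    (hI : I ∈ 𝓘.sets i) (T : ℕ) {b : ℕ → ℝ}
    (hb : ∀ t, ∀ a ∈ G.actsAt I, |G.regretAt i (σ t) I a| ≤ b t) {a : A} (ha : a ∈ G.actsAt I) :
    ∑ t ∈ Finset.range T, G.regretAt i (σ t) I a ≤
      √((G.actsAt I).card : ℝ) * √(∑ t ∈ Finset.range T, b t ^ 2) := by
  obtain ⟨h₀, h₀I⟩ := 𝓘.nonempty_of_mem hI
  refine le_of_regret_matching (r := fun t a => G.regretAt i (σ t) I a)
    (p := fun t a => σ t i h₀ a) ?_ (fun t => (hσ t).sum_mul_regretAt hI h₀I) T hb ha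
  intro t a ha
  have h1 := hcfr t I hI h₀ h₀I a ha
  rw [Finset.sum_congr rfl fun b hb => by rw [𝓘.cfRegret_eq σ t hI hb],
    𝓘.cfRegret_eq σ t hI ha] at h1
  exact h1

section Bound

variable {𝓘 𝓙 : G.Info} {k δ ℓ : Finset (List A) → Finset (List A) → ℝ} {i : N}
  {σ : ℕ → N → List A → A → ℝ} {T : ℕ}

/-- The trivial constants of a diagonal pair are what guarantees K ≥ 1. -/
theorem one_le_maxPairs (hab : 𝓘.IsAbstractionOf 𝓙)
    (hself : ∀ J ∈ 𝓙.sets i, k J J = 1 ∧ ℓ J J = 1) {I : Finset (List A)} (hI : I ∈ 𝓘.sets i) :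
    1 ≤ 𝓙.maxPairs i I (fun J J' => k J J' * ℓ J J') := by
  obtain ⟨h, hh⟩ := 𝓘.nonempty_of_mem hI
  have hJ := hab.exists_superset hI hh
  have := 𝓙.le_maxPairs (fun J J' => k J J' * ℓ J J') hJ hJ
  obtain ⟨h1, h2⟩ := hself _ (Info.mem_refined.1 hJ).1
  simpa [h1, h2] using this

theorem Info.IsSkewWellFormed.maxPairs_nonneg (hskew : 𝓘.IsSkewWellFormed 𝓙 k δ ℓ)
    {I : Finset (List A)} (hI : I ∈ 𝓘.sets i) :
    0 ≤ 𝓙.maxPairs i I (fun J J' => δ J J' * ℓ J J') := by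
  refine Real.sSup_nonneg ?_
  rintro _ ⟨⟨J, J'⟩, hp, rfl⟩
  obtain ⟨hJ, hJ'⟩ := Finset.mem_product.1 (Finset.mem_coe.1 hp)
  obtain ⟨-, h1, h2, -⟩ := hskew.2 i I hI J hJ J' hJ'
  exact mul_nonneg h1 h2

theorem Info.IsSkewWellFormed.sum_regretAt_support_le (hskew : 𝓘.IsSkewWellFormed 𝓙 k δ ℓ)
    (hself : ∀ J ∈ 𝓙.sets i, k J J = 1 ∧ ℓ J J = 1) (hσ : ∀ t, 𝓘.IsProfile (σ t))
    (hcfr : 𝓘.IsCFR i σ) (hT : 0 < T) {s : List A → A → ℝ} (hs : 𝓙.IsStrategy i s)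
    {act : Finset (List A) → A} (hact : ∀ J ∈ 𝓙.sets i, act J ∈ G.actsAt J)
    {I : Finset (List A)} (hI : I ∈ 𝓘.sets i) :
    ∑ J ∈ support 𝓙 i s ∩ 𝓙.refined i I, ∑ t ∈ Finset.range T, G.regretAt i (σ t) J (act J) ≤
      𝓙.maxPairs i I (fun J J' => k J J' * ℓ J J') *
          (√(𝓘.maxActs i : ℝ) * (G.utilRange i * √(T : ℝ))) +
        𝓙.maxPairs i I (fun J J' => δ J J' * ℓ J J') * (T * (𝓙.refined i I).card) := by
  obtain ⟨h𝓙, hab⟩ := hskew.1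
  have hst := fun t => (hσ t).stochastic
  have hactsAt : ∀ J ∈ 𝓙.refined i I, G.actsAt J = G.actsAt I := fun J hJ => by
    obtain ⟨hJs, hJI⟩ := Info.mem_refined.1 hJ
    obtain ⟨h, hh⟩ := 𝓙.nonempty_of_mem hJs
    rw [𝓙.actsAt_eq hJs hh, 𝓘.actsAt_eq hI (hJI hh)]
  have hsets : ∀ J ∈ 𝓙.refined i I, J ∈ 𝓙.sets i := fun J hJ => (Info.mem_refined.1 hJ).1
  have hK := one_le_maxPairs hab hself hI
  have hcore := sum_regret_le (P := 𝓙.refined i I) (S := support 𝓙 i s ∩ 𝓙.refined i I)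
    (B := G.actsAt I) (r := fun t J a => G.regretAt i (σ t) J a)
    (q := fun t J => G.oppReach i (σ t) J) (κ := fun J J' => k J J' * ℓ J J') (lam := ℓ)
    (Δ := G.utilRange i) (n := √((G.actsAt I).card : ℝ)) (T := T) (act := act)
    Finset.inter_subset_right ((hst 0).utilRange_nonneg i) (hskew.maxPairs_nonneg hI) hK
    (Real.sqrt_nonneg _) hT
    (fun t J hJ => (hst t).oppReach_nonneg i fun _ => 𝓙.mem_H (hsets J hJ))
    (fun t J hJ => h𝓙.oppReach_le_one (hst t) (hsets J hJ))
    (fun t => sum_support_oppReach_le_one hs (hst t) (𝓘.prefixFree hI) Finset.inter_subset_left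
      fun J hJ => (Info.mem_refined.1 (Finset.mem_inter.1 hJ).2).2)
    (fun J hJ J' hJ' => ⟨(hskew.2 i I hI J hJ J' hJ').2.2.1,
      fun t => hskew.oppReach_eq hI hJ hJ' (hσ t)⟩)
    (fun J hJ J' hJ' => by
      obtain ⟨h1, -, h2, -⟩ := hskew.2 i I hI J hJ J' hJ'
      exact ⟨mul_nonneg h1 h2, 𝓙.le_maxPairs (fun J J' => k J J' * ℓ J J') hJ hJ'⟩)
    (fun t J hJ a ha => 𝓙.abs_regretAt_le (hst t) (hsets J hJ) (by rwa [hactsAt J hJ]))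
    (fun t J hJ J' hJ' a ha => (hskew.abs_regretAt_sub_le hI hJ hJ' (hσ t) ha).trans <| by
      have h1 := 𝓙.le_maxPairs (fun J J' => δ J J' * ℓ J J') hJ hJ'
      have h2 := (hst t).oppReach_nonneg i (fun _ => 𝓙.mem_H (hsets J' hJ'))
      exact mul_le_mul_of_nonneg_right (by linarith) h2)
    (fun b hb a ha => by
      simp only [hab.sum_regretAt hI] at hb ⊢
      exact hcfr.sum_regretAt_le hσ hI T hb ha)
    (fun J hJ => by
      have hJ := Finset.mem_inter.1 hJ
      rw [← hactsAt J hJ.2]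
      exact hact J (hsets J hJ.2))
  refine hcore.trans ?_
  have hn : √((G.actsAt I).card : ℝ) ≤ √(𝓘.maxActs i : ℝ) := by
    refine Real.sqrt_le_sqrt ?_
    exact_mod_cast Finset.le_sup (f := fun I => (G.actsAt I).card) hI
  have hΔ := (hst 0).utilRange_nonneg i
  gcongr

theorem Info.IsSkewWellFormed.gain_le (hskew : 𝓘.IsSkewWellFormed 𝓙 k δ ℓ)
    (hself : ∀ J ∈ 𝓙.sets i, k J J = 1 ∧ ℓ J J = 1) (hσ : ∀ t, 𝓘.IsProfile (σ t))
    (hcfr : 𝓘.IsCFR i σ) (hT : 0 < T) {s : List A → A → ℝ} (hs : 𝓙.IsStrategy i s) :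
    G.gain i σ T s ≤ G.utilRange i *
        (∑ I ∈ 𝓘.sets i, 𝓙.maxPairs i I (fun J J' => k J J' * ℓ J J')) *
          √(𝓘.maxActs i : ℝ) * √(T : ℝ) +
      T * ∑ I ∈ 𝓘.sets i,
        ((𝓙.refined i I).card : ℝ) * 𝓙.maxPairs i I (fun J J' => δ J J' * ℓ J J') := by
  obtain ⟨h𝓙, hab⟩ := hskew.1
  obtain ⟨s', hs', hpure, hle⟩ := 𝓙.exists_pure σ T hs
  refine hle.trans ?_
  have hprof : ∀ t, 𝓙.IsProfile (σ t) := fun t j => hab.isStrategy (hσ t j)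
  -- Choosing an action for every set, relevant or not, needs `A` to be inhabited; without actions
  -- nobody moves and all terms vanish.
  rcases isEmpty_or_nonempty A with hA | hA
  · have hempty : G.nodes i = ∅ := Finset.eq_empty_of_forall_notMem fun h hh => by
      obtain ⟨a, -⟩ := (mem_nodes.1 hh).2.1
      exact hA.elim a
    have hsets : ∀ 𝓚 : G.Info, 𝓚.sets i = ∅ := fun 𝓚 => Finset.eq_empty_of_forall_notMem
      fun I hI => by
        obtain ⟨h, hh⟩ := 𝓚.nonempty_of_mem hI
        have := 𝓚.subset_nodes hI hh
        rw [hempty] at this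
        exact Finset.notMem_empty _ this
    simp [gain, value_update_sub, hempty, hsets]
  choose! act hact using hpure
  have hsum : G.gain i σ T s' =
      ∑ I ∈ 𝓘.sets i, ∑ J ∈ support 𝓙 i s' ∩ 𝓙.refined i I,
        ∑ t ∈ Finset.range T, G.regretAt i (σ t) J (act J) := by
    rw [← hab.sum_sets (S := support 𝓙 i s') (Finset.filter_subset _ _), Finset.sum_comm]
    exact Finset.sum_congr rfl fun t _ => h𝓙.value_update_sub_eq hs' hact (hprof t)
  rw [hsum]
  refine (Finset.sum_le_sum fun I hI => hskew.sum_regretAt_support_le hself hσ hcfr hT hs'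
    (fun J hJ => (hact J hJ).1) hI).trans (le_of_eq ?_)
  rw [Finset.sum_add_distrib, ← Finset.sum_mul, Finset.mul_sum (a := (T : ℝ))]
  congr 1
  · ring
  · exact Finset.sum_congr rfl fun I _ => by ring

end Bound

end GameTree

end

theorem theorem2 {N A : Type*} [Fintype N] [DecidableEq N] [Fintype A] [DecidableEq A]
    (G : GameTree N A) (𝓘 𝓙 : G.Info)
    (k δ ℓ : Finset (List A) → Finset (List A) → ℝ)
    (hskew : 𝓘.IsSkewWellFormed 𝓙 k δ ℓ)
    (i : N)
    -- an information set of the refinement is compared with itself by the trivial constants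
    (hself : ∀ J ∈ 𝓙.sets i, k J J = 1 ∧ ℓ J J = 1)
    (σ : ℕ → N → List A → A → ℝ)
    (hσ : ∀ t, 𝓘.IsProfile (σ t))
    (hcfr : 𝓘.IsCFR i σ)
    (T : ℕ) (hT : 0 < T) :
    BddAbove (𝓙.gains i σ T) ∧
    𝓙.regret i σ T / T ≤
      G.utilRange i * (∑ I ∈ 𝓘.sets i, 𝓙.maxPairs i I (fun J J' => k J J' * ℓ J J'))
          * √(𝓘.maxActs i : ℝ) / √(T : ℝ)
        + ∑ I ∈ 𝓘.sets i,
            ((𝓙.refined i I).card : ℝ) * 𝓙.maxPairs i I (fun J J' => δ J J' * ℓ J J') := by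
  have hbound : ∀ x ∈ 𝓙.gains i σ T, x ≤ G.utilRange i *
        (∑ I ∈ 𝓘.sets i, 𝓙.maxPairs i I (fun J J' => k J J' * ℓ J J')) *
          √(𝓘.maxActs i : ℝ) * √(T : ℝ) +
      T * ∑ I ∈ 𝓘.sets i,
        ((𝓙.refined i I).card : ℝ) * 𝓙.maxPairs i I (fun J J' => δ J J' * ℓ J J') := by
    rintro x ⟨s, hs, rfl⟩
    exact hskew.gain_le hself hσ hcfr hT hs
  refine ⟨⟨_, hbound⟩, ?_⟩
  have hT0 : (0 : ℝ) < T := by exact_mod_cast hT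
  -- The supremum can be bounded by `csSup_le` only over a nonempty set; a strategy of the coarse
  -- game is also one of the refinement.
  have hne : (𝓙.gains i σ T).Nonempty := ⟨_, σ 0 i, hskew.1.2.isStrategy (hσ 0 i), rfl⟩
  rw [div_le_iff₀ hT0]
  refine (csSup_le hne hbound).trans (le_of_eq ?_)
  have hs : √(T : ℝ) ≠ 0 := (Real.sqrt_pos.2 hT0).ne'
  have hTT : (T : ℝ) = √(T : ℝ) * √(T : ℝ) := (Real.mul_self_sqrt hT0.le).symm
  rw [add_mul, div_mul_eq_mul_div, mul_comm (T : ℝ)]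
  congr 1
  rw [eq_div_iff hs, mul_assoc, ← hTT]
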